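/- Fix constants $\phi, C, c > 0$. Let $H=(H_{ij})$ be a real symmetric $N\times N$ random matrix with $H_{ii}=0$ almost surely, whose off-diagonal entries are independent (up to $H_{ij}=H_{ji}$) and identically distributed, with $$\mathbb E H_{ij}=0,\qquad \mathbb E H_{ij}^2=\frac{1-\delta_{ij}}{N},\qquad \mathbb E|H_{ij}|^k\le \frac{(Ck)^{ck}}{Nq^{k-2}}\quad(k\ge 3),$$ where the sparsity parameter $q$ satisfies $N^{\phi}\le q\le N^{1/2}$. Let $s^{(4)}=Nq^2\kappa^{(4)}$, where $\kappa^{(4)}$ is the fourth cumulant of the off-diagonal entries. For $t\ge 0$ set $q_t=q\,e^{t/2}$ and $$P_{t,z}(w)=1+zw+w^2+e^{-t}q_t^{-2}s^{(4)}w^4 ,$$ and let $\mathcal E=\{z=E+\mathrm i\eta:\ |E|<3,\ 0<\eta\le 3\}$. There exist $N_0\in\mathbb N$ and $K\ge 1$, depending only on $\phi, C, c$, such that for all $N\ge N_0$, all such $q$ and $H$, and all $t\ge 0$ the following holds. We write $a\sim b$ for $K^{-1}b\le a\le Kb$. For every $z\in\mathcal E$ the equation $P_{t,z}(w_t)=0$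 has a unique solution $w_t=w_t(z)$ with $\operatorname{Im}w_t>0$ and $|w_t|\le 5$. Moreover: 1. There is a probability measure $\widetilde\rho_t$ on $\mathbb R$ such that $w_t$ extends from $\mathcal E$ to an analytic function on the upper half-plane $\{\operatorname{Im} z>0\}$, and this extension equals the Stieltjes transform $z\mapsto\int_{\mathbb R}\frac{d\widetilde\rho_t(x)}{x-z}$. 2. The support of $\widetilde\rho_t$ is $[-L_t,L_t]$ for some $L_t>0$, with $L_t\ge 2$ whenever $s^{(4)}\ge 0$. The measure $\widetilde\rho_t$ is absolutely continuous, with a density (also denoted $\widetilde\rho_t$) that is strictly positive on $(-L_t,L_t)$ and satisfies there $$\widetilde\rho_t(E)\sim\kappa_t(E)^{1/2},\qquad \kappa_t(E)=\min\{|E+L_t|,|E-L_t|\}.$$ Moreover $$\bigl|L_t-2-e^{-t}q_t^{-2}s^{(4)}\bigr|\le K\,e^{-2t}q_t^{-4}.$$ 3. For $z=E+\mathrm i\eta\in\mathcal E$, $$\operatorname{Im}w_t(z)\sim\sqrt{\kappa_t(E)+\eta}\quad\text{if }E\in[-L_t,L_t],\qquad \operatorname{Im}w_t(z)\sim\frac{\eta}{\sqrt{\kappa_t(E)+\eta}}\quad\text{if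 }E\notin[-L_t,L_t].$$ -/

import Mathlib

open MeasureTheory ProbabilityTheory

noncomputable section

namespace SparseRM

/-- The cumulants of a real random variable with finite moments, determined by the
moment-cumulant relation
`m (n+1) = ∑ k ≤ n, (n choose k) * κ (k+1) * m (n-k)`. -/
def cumulant {Ω : Type*} [MeasurableSpace Ω] (μ : Measure Ω) (X : Ω → ℝ) : ℕ → ℝ
  | 0 => 0
  | n + 1 => moment X (n + 1) μ -
      ∑ k : Fin n, (n.choose k : ℝ) * cumulant μ X (k + 1) * moment X (n - k) μ
  decreasing_by exact Nat.succ_lt_succ k.isLt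

/-- The normalized cumulants `s⁽¹⁾ = 0`, `s⁽²⁾ = 1`, `s⁽ᵏ⁾ = N q^(k-2) κ⁽ᵏ⁾` for `k ≥ 3`,
of an entry `X` of an `N × N` matrix with sparsity parameter `q`. -/
def normalizedCumulant {Ω : Type*} [MeasurableSpace Ω] (μ : Measure Ω) (N : ℕ) (q : ℝ)
    (X : Ω → ℝ) : ℕ → ℝ
  | 0 => 0
  | 1 => 0
  | 2 => 1
  | k + 3 => (N : ℝ) * q ^ (k + 1) * cumulant μ X (k + 3)

/-- A sparse real symmetric random matrix `H` of size `N` with sparsity parameter `q`: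
zero diagonal, off-diagonal entries i.i.d. up to symmetry, centred, of variance `1 / N`, with
`N^φ ≤ q ≤ N^(1/2)` and `𝔼|H i j|^k ≤ (C k)^(c k) / (N q^(k-2))` for `k ≥ 3`. -/
structure IsSparseMatrix (φ C c : ℝ) {N : ℕ} (q : ℝ) {Ω : Type*} [MeasurableSpace Ω]
    (μ : Measure Ω) (H : Ω → Matrix (Fin N) (Fin N) ℝ) : Prop where
  le_q : (N : ℝ) ^ φ ≤ q
  q_le : q ≤ (N : ℝ) ^ (1 / 2 : ℝ)
  measurable : ∀ i j, Measurable fun ω => H ω i j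
  symm : ∀ ω, (H ω).IsSymm
  diag : ∀ i, ∀ᵐ ω ∂μ, H ω i i = 0
  indep : iIndepFun
    (fun (p : {p : Fin N × Fin N // p.1 < p.2}) (ω : Ω) => H ω p.1.1 p.1.2) μ
  identDistrib : ∀ i j k l, i ≠ j → k ≠ l →
    IdentDistrib (fun ω => H ω i j) (fun ω => H ω k l) μ μ
  integrable : ∀ i j, ∀ k : ℕ, Integrable (fun ω => |H ω i j| ^ k) μ
  mean : ∀ i j, ∫ ω, H ω i j ∂μ = 0
  variance : ∀ i j, ∫ ω, H ω i j ^ 2 ∂μ = (1 - if i = j then 1 else 0) / (N : ℝ)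
  moment_le : ∀ i j, ∀ k : ℕ, 3 ≤ k →
    ∫ ω, |H ω i j| ^ k ∂μ ≤ (C * k) ^ (c * k) / ((N : ℝ) * q ^ (k - 2))

/-- The domain of `z = E + i η` with `|E| < 3` and `0 < η ≤ 3`. -/
def domainE : Set ℂ := {z | |z.re| < 3 ∧ 0 < z.im ∧ z.im ≤ 3}

/-- The time-dependent sparsity parameter `q_t = q e^(t/2)`. -/
def qt (q t : ℝ) : ℝ := q * Real.exp (t / 2)

/-- `P_{t,z}(w) = 1 + z w + w² + e^(-t) q_t^(-2) s w⁴`, with `s` the fourth normalized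
cumulant. -/
def P (q s t : ℝ) (z w : ℂ) : ℂ :=
  1 + z * w + w ^ 2 + ((Real.exp (-t) * (qt q t ^ 2)⁻¹ * s : ℝ) : ℂ) * w ^ 4

/-- `w` is a root of `P_{t,z}` with `Im w > 0` and `|w| ≤ 5`. -/
def IsSolution (q s t : ℝ) (z w : ℂ) : Prop :=
  P q s t z w = 0 ∧ 0 < w.im ∧ ‖w‖ ≤ 5

/-- The Stieltjes transform `∫ dν(x) / (x - z)`. -/
def stieltjes (ν : Measure ℝ) (z : ℂ) : ℂ := ∫ x, ((x : ℂ) - z)⁻¹ ∂ν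

/-- The distance `κ_t(E) = min (|E + L|, |E - L|)` to the edges. -/
def kappa (L E : ℝ) : ℝ := min |E + L| |E - L|

/-- `a ∼ b` with comparison constant `K`, for non-negative quantities. -/
def Comparable (K a b : ℝ) : Prop := K⁻¹ * b ≤ a ∧ a ≤ K * b

end SparseRM

end

noncomputable section
namespace SparseRM

/-! Put a = e^(-t) q_t^(-2) s. The moment bounds control s by a constant, and q ≥ N^φ makes |a| ≤
1/10000 for large N, so everything reduces to a deterministic small perturbation of the semicircle
equation 1 + zw + w² = 0.

The equation says that z = -1/w - w - a w³. The divided difference of this map does not vanish on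
the upper half disc (`mul_mul_ne_one`), which gives uniqueness and local invertibility; existence
follows by connectedness of the half plane (`exists_isRoot_of_im_pos`). The resulting `branch` is
holomorphic, continuous up to ℝ and close to -1/z at infinity, so by contour integration it is the
Stieltjes transform of its boundary imaginary part divided by π (`integral_im_mul_inv_eq`).

The edge L is a critical value of w ↦ 1/w + w + a w³, attained at w² = X. Hence (z² - L²) w² = (w² -
X)² M with M near 1, which is the square-root singularity. Writing D for `defect`, one has Im z ·
|w|² = Im w · D, and Im w + D is comparable to √(κ + η) (`sqrt_kappa_bounds`). Between the edges Im
w dominates D; outside them D dominates Im w (`inside_outside`). These two cases give the two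
regimes of Im w. -/

/-- `w` is a root of `1 + z w + w² + a w⁴` in the closure of the image of the upper half plane
under the inverse of `w ↦ -1/w - w - a w³`. -/
def IsRoot (a : ℝ) (z w : ℂ) : Prop :=
  1 + z * w + w ^ 2 + (a : ℂ) * w ^ 4 = 0 ∧ 0 ≤ w.im ∧ ‖w‖ ≤ 5 ∧
    0 ≤ 1 - (w.re ^ 2 + w.im ^ 2) * (1 + a * (3 * w.re ^ 2 - w.im ^ 2))

/-- The defect `|w|² Im z / Im w`, expressed through `w`. -/
def defect (a : ℝ) (w : ℂ) : ℝ :=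
  1 - (w.re ^ 2 + w.im ^ 2) * (1 + a * (3 * w.re ^ 2 - w.im ^ 2))

/-! ### Uniqueness of the root in the upper half disc. -/

lemma ne_zero_of_eq {a : ℝ} {z w : ℂ} (h : 1 + z * w + w ^ 2 + (a : ℂ) * w ^ 4 = 0) : w ≠ 0 := by
  rintro rfl
  simp at h

lemma normSq_pos_of_ne {w : ℂ} (h : w ≠ 0) : 0 < w.re ^ 2 + w.im ^ 2 := by
  have := Complex.normSq_pos.2 h
  rw [Complex.normSq_apply] at this
  nlinarith

lemma sq_norm_eq (w : ℂ) : ‖w‖ ^ 2 = w.re ^ 2 + w.im ^ 2 := by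
  rw [Complex.sq_norm, Complex.normSq_apply]; ring

lemma re_im_of_eq {a : ℝ} {z w : ℂ} (h : 1 + z * w + w ^ 2 + (a : ℂ) * w ^ 4 = 0) :
    z.im * (w.re ^ 2 + w.im ^ 2) = w.im * defect a w ∧
    z.re * (w.re ^ 2 + w.im ^ 2) = -w.re * (1 + (w.re ^ 2 + w.im ^ 2) +
      a * (w.re ^ 2 + w.im ^ 2) * (w.re ^ 2 - 3 * w.im ^ 2)) := by
  have h1 := congrArg Complex.re h
  have h2 := congrArg Complex.im h
  simp [pow_succ, Complex.mul_re, Complex.mul_im] at h1 h2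
  unfold defect
  constructor
  · linear_combination w.re * h2 - w.im * h1
  · linear_combination w.re * h1 + w.im * h2

lemma abs_im_mul_le (x y : ℂ) : |(x * y).im| ≤ |x.im| * ‖y‖ + ‖x‖ * |y.im| := by
  rw [Complex.mul_im]
  calc |x.re * y.im + x.im * y.re| ≤ |x.re * y.im| + |x.im * y.re| := abs_add_le _ _
    _ ≤ _ := by
      rw [abs_mul, abs_mul, add_comm]
      have := Complex.abs_re_le_norm x
      have := Complex.abs_re_le_norm y
      gcongr

lemma abs_im_mul_mul_le {x y z : ℂ} (hx : ‖x‖ ≤ 5) (hy : ‖y‖ ≤ 5) (hz : ‖z‖ ≤ 5) :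
    |(x * y * z).im| ≤ 25 * (|x.im| + |y.im| + |z.im|) := by
  have h1 := abs_im_mul_le (x * y) z
  have h2 := abs_im_mul_le x y
  have h3 : ‖x * y‖ ≤ 25 := by rw [norm_mul]; nlinarith [norm_nonneg x, norm_nonneg y]
  have h4 : |(x * y).im| ≤ 5 * |x.im| + 5 * |y.im| := by
    nlinarith [abs_nonneg x.im, abs_nonneg y.im]
  nlinarith [abs_nonneg x.im, abs_nonneg y.im, abs_nonneg z.im, abs_nonneg (x * y).im, norm_nonneg z,
    norm_nonneg (x * y)]

/-- The divided difference of `w ↦ -1/w - w - a w³` has no zeros on the upper half disc. -/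
lemma mul_mul_ne_one {a : ℝ} (ha : |a| ≤ 1 / 10000) {x y : ℂ} (hx : ‖x‖ ≤ 5) (hy : ‖y‖ ≤ 5)
    (hxi : 0 ≤ x.im) (hyi : 0 ≤ y.im) (h : 0 < x.im + y.im) :
    x * y * (1 + a * (x ^ 2 + x * y + y ^ 2)) ≠ 1 := by
  intro he
  have hx0 : x ≠ 0 := by rintro rfl; simp at he
  have hy0 : y ≠ 0 := by rintro rfl; simp at he
  -- The equation is multiplied by (x + y)/(xy). On the left, inversion makes the imaginary part
  -- nonpositive; on the right it is at least (1 - 225/10000)(Im x + Im y) > 0.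
  have key : x⁻¹ + y⁻¹ = x + y + a * (x * x * x + 2 * (x * x * y) + 2 * (x * y * y) + y * y * y) := by
    field_simp
    linear_combination -(x + y) * he
  have hi := congrArg Complex.im key
  have b1 := abs_le.1 (abs_im_mul_mul_le hx hx hx)
  have b2 := abs_le.1 (abs_im_mul_mul_le hx hx hy)
  have b3 := abs_le.1 (abs_im_mul_mul_le hx hy hy)
  have b4 := abs_le.1 (abs_im_mul_mul_le hy hy hy)
  rw [abs_of_nonneg hxi] at b1 b2 b3
  rw [abs_of_nonneg hyi] at b2 b3 b4
  rw [Complex.add_im, Complex.add_im, Complex.add_im, Complex.inv_im, Complex.inv_im,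
    Complex.im_ofReal_mul] at hi
  simp only [Complex.add_im, show ∀ u : ℂ, (2 * u).im = 2 * u.im by intro u; simp] at hi
  have hS : |(x * x * x).im + 2 * (x * x * y).im + 2 * (x * y * y).im + (y * y * y).im|
      ≤ 225 * (x.im + y.im) := by
    rw [abs_le]; constructor <;> linarith
  have hT : |a * ((x * x * x).im + 2 * (x * x * y).im + 2 * (x * y * y).im + (y * y * y).im)|
      ≤ 1 / 10000 * (225 * (x.im + y.im)) := by
    rw [abs_mul]; gcongr
  have l1 : -x.im / Complex.normSq x ≤ 0 :=
    div_nonpos_of_nonpos_of_nonneg (by linarith) (Complex.normSq_nonneg _)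
  have l2 : -y.im / Complex.normSq y ≤ 0 :=
    div_nonpos_of_nonpos_of_nonneg (by linarith) (Complex.normSq_nonneg _)
  have := (abs_le.1 hT).1
  linarith

lemma mul_mul_eq_one_of_eq {a : ℝ} {z x y : ℂ} (hx : 1 + z * x + x ^ 2 + (a : ℂ) * x ^ 4 = 0)
    (hy : 1 + z * y + y ^ 2 + (a : ℂ) * y ^ 4 = 0) (h : x ≠ y) :
    x * y * (1 + a * (x ^ 2 + x * y + y ^ 2)) = 1 := by
  have : x - y ≠ 0 := sub_ne_zero.2 h
  apply mul_left_cancel₀ this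
  linear_combination y * hx - x * hy

/-- Roots in the upper half disc are unique. -/
lemma eq_of_im_pos {a : ℝ} (ha : |a| ≤ 1 / 10000) {z x y : ℂ}
    (hx : 1 + z * x + x ^ 2 + (a : ℂ) * x ^ 4 = 0) (hy : 1 + z * y + y ^ 2 + (a : ℂ) * y ^ 4 = 0)
    (hxn : ‖x‖ ≤ 5) (hyn : ‖y‖ ≤ 5) (hxi : 0 ≤ x.im) (hyi : 0 ≤ y.im) (h : 0 < x.im + y.im) :
    x = y := by
  by_contra hne
  exact mul_mul_ne_one ha hxn hyn hxi hyi h (mul_mul_eq_one_of_eq hx hy hne)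

/-- Only the case of two real roots is new, and there the sign condition decides. Adding x² + 3ax⁴ ≤
1 to its analogue for y and subtracting twice the divided-difference equation gives (x - y)² (1 +
a(3x² + 4xy + 3y²)) ≤ 0, although the second factor is positive. -/
lemma IsRoot.unique {a : ℝ} (ha : |a| ≤ 1 / 10000) {z x y : ℂ} (hx : IsRoot a z x)
    (hy : IsRoot a z y) : x = y := by
  obtain ⟨hx, hxi, hxn, hxd⟩ := hx
  obtain ⟨hy, hyi, hyn, hyd⟩ := hy
  by_cases h : 0 < x.im + y.im
  · exact eq_of_im_pos ha hx hy hxn hyn hxi hyi h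
  by_contra hne
  have hx0 : x.im = 0 := by linarith
  have hy0 : y.im = 0 := by linarith
  have he := congrArg Complex.re (mul_mul_eq_one_of_eq hx hy hne)
  have hre : x.re ≠ y.re := fun h => hne (Complex.ext h (by rw [hx0, hy0]))
  simp [pow_succ, hx0, hy0] at he
  rw [hx0] at hxd
  rw [hy0] at hyd
  have hxr := (Complex.abs_re_le_norm x).trans hxn
  have hyr := (Complex.abs_re_le_norm y).trans hyn
  have hpos : 0 < (x.re - y.re) ^ 2 := by
    have := sub_ne_zero.2 hre
    positivity
  have hB : |3 * x.re ^ 2 + 4 * (x.re * y.re) + 3 * y.re ^ 2| ≤ 250 := by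
    rw [abs_le] at *
    constructor <;> nlinarith
  have hA : |a * (3 * x.re ^ 2 + 4 * (x.re * y.re) + 3 * y.re ^ 2)| ≤ 1 / 10000 * 250 := by
    rw [abs_mul]; gcongr
  have h3 : 0 < 1 + a * (3 * x.re ^ 2 + 4 * (x.re * y.re) + 3 * y.re ^ 2) := by
    have := (abs_le.1 hA).1
    linarith
  nlinarith [mul_pos hpos h3]

/-- The sign condition improves the radius 5 to nearly 1. Roots thus stay away from the circle of
radius 5, so the bound by 5 survives small perturbations of z. -/
lemma IsRoot.normSq_le {a : ℝ} (ha : |a| ≤ 1 / 10000) {z w : ℂ} (h : IsRoot a z w) :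
    w.re ^ 2 + w.im ^ 2 ≤ 1.01 := by
  obtain ⟨-, -, hn, hd⟩ := h
  have hp : w.re ^ 2 + w.im ^ 2 ≤ 25 := by
    rw [← sq_norm_eq]; nlinarith [norm_nonneg w]
  have h1 : |3 * w.re ^ 2 - w.im ^ 2| ≤ 75 := by
    rw [abs_le]; constructor <;> nlinarith [sq_nonneg w.re, sq_nonneg w.im]
  have h2 : |a * (3 * w.re ^ 2 - w.im ^ 2)| ≤ 1 / 10000 * 75 := by
    rw [abs_mul]; gcongr
  have := (abs_le.1 h2).1
  nlinarith [sq_nonneg w.re, sq_nonneg w.im]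

lemma IsRoot.norm_le {a : ℝ} (ha : |a| ≤ 1 / 10000) {z w : ℂ} (h : IsRoot a z w) : ‖w‖ ≤ 1.01 := by
  have := h.normSq_le ha
  rw [← sq_norm_eq] at this
  nlinarith [norm_nonneg w]

/-- For `Im z > 0` the sign condition is automatic. -/
lemma isRoot_of_im_pos {a : ℝ} {z w : ℂ} (h : 1 + z * w + w ^ 2 + (a : ℂ) * w ^ 4 = 0)
    (hz : 0 < z.im) (hw : 0 < w.im) (hn : ‖w‖ ≤ 5) : IsRoot a z w := by
  refine ⟨h, hw.le, hn, ?_⟩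
  have h1 := (re_im_of_eq h).1
  have h2 := normSq_pos_of_ne (ne_zero_of_eq h)
  have h3 : 0 < w.im * defect a w := h1 ▸ mul_pos hz h2
  exact ((pos_iff_pos_of_mul_pos h3).1 hw).le

lemma IsRoot.im_pos {a : ℝ} {z w : ℂ} (h : IsRoot a z w) (hz : 0 < z.im) : 0 < w.im := by
  have h1 := (re_im_of_eq h.1).1
  have h2 := normSq_pos_of_ne (ne_zero_of_eq h.1)
  have h3 : 0 < w.im * defect a w := h1 ▸ mul_pos hz h2
  rcases h.2.1.lt_or_eq with h4 | h4
  · exact h4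
  · rw [← h4] at h3; simp at h3

/-! ### Existence of the root by connectedness. -/

-- Roots lie in a compact ball, and projection along a compact factor is a closed map. A general S
-- is allowed so that the same fact yields continuity of `branch`.
open Topology Filter in
lemma isClosed_setOf_exists_isRoot (a : ℝ) {S : Set ℂ} (hS : IsClosed S) :
    IsClosed {z | ∃ w ∈ S, IsRoot a z w} := by
  have hcl : IsClosed {p : ℂ × Metric.closedBall (0 : ℂ) 5 | (p.2 : ℂ) ∈ S ∧ IsRoot a p.1 p.2} := by
    simp only [IsRoot, Set.ofPred_and]
    refine (hS.preimage (by fun_prop)).inter ?_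
    refine (isClosed_eq (by fun_prop) (by fun_prop)).inter ?_
    refine (isClosed_le (by fun_prop) (by fun_prop)).inter ?_
    refine (isClosed_le (by fun_prop) (by fun_prop)).inter ?_
    exact isClosed_le (by fun_prop) (by fun_prop)
  have := isClosedMap_fst_of_compactSpace _ hcl
  convert this using 1
  ext z
  constructor
  · rintro ⟨w, hw, h⟩
    exact ⟨(z, ⟨w, by simpa using h.2.2.1⟩), ⟨hw, h⟩, rfl⟩
  · rintro ⟨⟨z', w⟩, ⟨hw, h⟩, rfl⟩
    exact ⟨w, hw, h⟩

/-- The rational map inverted by the roots of `1 + z w + w² + a w⁴`. -/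
def invMap (a : ℝ) (w : ℂ) : ℂ := -(1 + w ^ 2 + a * w ^ 4) / w

lemma eq_iff_invMap {a : ℝ} {z w : ℂ} (hw : w ≠ 0) :
    1 + z * w + w ^ 2 + (a : ℂ) * w ^ 4 = 0 ↔ invMap a w = z := by
  unfold invMap
  rw [div_eq_iff hw]
  constructor <;> intro h <;> linear_combination -h

/-- The numerator is left as the divided difference at x = y = w, the form to which `mul_mul_ne_one`
applies. -/
lemma hasStrictDerivAt_invMap (a : ℝ) {w : ℂ} (hw : w ≠ 0) :
    HasStrictDerivAt (invMap a) ((1 - w * w * (1 + a * (w ^ 2 + w * w + w ^ 2))) / w ^ 2) w := by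
  have h1 : HasStrictDerivAt (fun w : ℂ => -(1 + w ^ 2 + a * w ^ 4))
      (-(0 + 2 * w + a * (4 * w ^ 3))) w := by
    refine HasStrictDerivAt.neg ?_
    refine ((hasStrictDerivAt_const _ _).add ?_).add ?_
    · simpa using hasStrictDerivAt_pow 2 w
    · simpa using (hasStrictDerivAt_pow 4 w).const_mul (a : ℂ)
  have h2 : HasStrictDerivAt (invMap a)
      ((-(0 + 2 * w + a * (4 * w ^ 3)) * id w - -(1 + w ^ 2 + a * w ^ 4) * 1) / id w ^ 2) w :=
    h1.div (hasStrictDerivAt_id w) hw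
  have h3 : -(0 + 2 * w + a * (4 * w ^ 3)) * id w - -(1 + w ^ 2 + a * w ^ 4) * 1 =
      1 - w * w * (1 + a * (w ^ 2 + w * w + w ^ 2)) := by
    simp only [id]
    ring
  rwa [h3] at h2

lemma deriv_invMap_ne_zero {a : ℝ} (ha : |a| ≤ 1 / 10000) {w : ℂ} (hn : ‖w‖ ≤ 5) (hi : 0 < w.im) :
    (1 - w * w * (1 + a * (w ^ 2 + w * w + w ^ 2))) / w ^ 2 ≠ 0 := by
  have hw : w ≠ 0 := by rintro rfl; simp at hi
  refine div_ne_zero (sub_ne_zero.2 ?_) (pow_ne_zero _ hw)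
  exact (mul_mul_ne_one ha hn hn hi.le hi.le (by linarith)).symm

-- The set of z with a root is relatively closed in the half plane by compactness, open because
-- `invMap` is locally open at w, and nonempty because it contains the image of i/2.
open Topology Filter in
lemma exists_isRoot_of_im_pos {a : ℝ} (ha : |a| ≤ 1 / 10000) {z : ℂ} (hz : 0 < z.im) :
    ∃ w, IsRoot a z w := by
  set U : Set ℂ := {z | 0 < z.im ∧ ∃ w, IsRoot a z w} with hU
  have hopenH : IsOpen {z : ℂ | 0 < z.im} := isOpen_lt continuous_const Complex.continuous_im
  have hopen : IsOpen U := by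
    rw [isOpen_iff_mem_nhds]
    rintro z ⟨hz, w, hw⟩
    have hwi := hw.im_pos hz
    have hw0 := ne_zero_of_eq hw.1
    have hz' := (eq_iff_invMap hw0).1 hw.1
    have hd := hasStrictDerivAt_invMap a hw0
    have hmap := hd.map_nhds_eq (deriv_invMap_ne_zero ha hw.2.2.1 hwi)
    have h5 : ‖w‖ < 5 := lt_of_le_of_lt (hw.norm_le ha) (by norm_num)
    rw [hz'] at hmap
    rw [← hmap, mem_map]
    have e1 : ∀ᶠ x in 𝓝 w, 0 < x.im := hopenH.mem_nhds hwi
    have e2 : ∀ᶠ x in 𝓝 w, ‖x‖ < 5 := (isOpen_lt continuous_norm continuous_const).mem_nhds h5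
    have e3 : ∀ᶠ x in 𝓝 w, 0 < (invMap a x).im :=
      hd.hasDerivAt.continuousAt.eventually (hopenH.mem_nhds (by rw [hz']; exact hz))
    filter_upwards [e1, e2, e3] with x h1 h2 h3
    have hx0 : x ≠ 0 := by rintro rfl; simp at h1
    exact ⟨h3, x, isRoot_of_im_pos ((eq_iff_invMap hx0).2 rfl) h3 h1 h2.le⟩
  have hpre : IsPreconnected {z : ℂ | 0 < z.im} := (convex_halfSpace_im_gt 0).isPreconnected
  have hne : ({z : ℂ | 0 < z.im} ∩ U).Nonempty := by
    have hw0 : (Complex.I / 2 : ℂ) ≠ 0 := by simp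
    have hi : 0 < (invMap a (Complex.I / 2)).im := by
      have h1 := (re_im_of_eq ((eq_iff_invMap (a := a) hw0).2 rfl)).1
      simp [defect] at h1
      have := abs_le.1 ha
      nlinarith
    refine ⟨invMap a (Complex.I / 2), hi, hi, Complex.I / 2, ?_⟩
    exact isRoot_of_im_pos ((eq_iff_invMap hw0).2 rfl) hi (by simp) (by simp; norm_num)
  refine (hpre.subset_of_closure_inter_subset hopen hne ?_ hz).2
  rintro x ⟨hx, hx'⟩
  refine ⟨hx', ?_⟩
  have hcl := isClosed_setOf_exists_isRoot a isClosed_univ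
  have : closure U ⊆ {z | ∃ w ∈ Set.univ, IsRoot a z w} :=
    closure_minimal (fun y hy => by simpa using hy.2) hcl
  simpa using this hx

/-- Real z are reached as limits; the non-strict inequalities in `IsRoot` make the condition closed
for this purpose. -/
lemma exists_isRoot {a : ℝ} (ha : |a| ≤ 1 / 10000) {z : ℂ} (hz : 0 ≤ z.im) :
    ∃ w, IsRoot a z w := by
  have hcl := isClosed_setOf_exists_isRoot a isClosed_univ
  have : closure {z : ℂ | 0 < z.im} ⊆ {z | ∃ w ∈ Set.univ, IsRoot a z w} :=
    closure_minimal (fun y hy => by simpa using exists_isRoot_of_im_pos ha hy) hcl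
  rw [Complex.closure_setOfPred_lt_im] at this
  simpa using this hz

/-! ### The branch, its regularity and its decay. -/

open Classical in
/-- The root of `1 + z w + w² + a w⁴` in the upper half disc, for `Im z ≥ 0`. -/
def branch (a : ℝ) (z : ℂ) : ℂ := if h : ∃ w, IsRoot a z w then h.choose else 0

lemma isRoot_branch {a : ℝ} (ha : |a| ≤ 1 / 10000) {z : ℂ} (hz : 0 ≤ z.im) :
    IsRoot a z (branch a z) := by
  have h := exists_isRoot ha hz
  rw [branch, dif_pos h]
  exact h.choose_spec

/-- By uniqueness, the preimage of a closed S is the set of z having a root in S, which is closed.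
-/
lemma continuousOn_branch {a : ℝ} (ha : |a| ≤ 1 / 10000) :
    ContinuousOn (branch a) {z | 0 ≤ z.im} := by
  rw [continuousOn_iff_isClosed]
  intro S hS
  refine ⟨_, isClosed_setOf_exists_isRoot a hS, ?_⟩
  ext z
  constructor
  · rintro ⟨h, hz⟩
    exact ⟨⟨branch a z, h, isRoot_branch ha hz⟩, hz⟩
  · rintro ⟨⟨w, hw, h⟩, hz⟩
    refine ⟨?_, hz⟩
    rw [Set.mem_preimage, (isRoot_branch ha hz).unique ha h]
    exact hw

open Topology Filter in
lemma differentiableOn_branch {a : ℝ} (ha : |a| ≤ 1 / 10000) :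
    DifferentiableOn ℂ (branch a) {z | 0 < z.im} := by
  intro z hz
  have hopenH : IsOpen {z : ℂ | 0 < z.im} := isOpen_lt continuous_const Complex.continuous_im
  have hw := isRoot_branch ha (le_of_lt hz)
  have hw0 := ne_zero_of_eq hw.1
  have hc : ContinuousAt (branch a) z :=
    (continuousOn_branch ha).continuousAt 
      (mem_of_superset (hopenH.mem_nhds hz) fun x (hx : 0 < x.im) => show 0 ≤ x.im from hx.le)
  refine (HasDerivAt.of_local_left_inverse hc (hasStrictDerivAt_invMap a hw0).hasDerivAt
    (deriv_invMap_ne_zero ha hw.2.2.1 (hw.im_pos hz)) ?_).differentiableAt.differentiableWithinAt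
  filter_upwards [hopenH.mem_nhds hz] with x hx
  have hx := isRoot_branch ha (le_of_lt hx)
  exact (eq_iff_invMap (ne_zero_of_eq hx.1)).1 hx.1

/-- This quantifies w ≈ -1/z at infinity. It gives the decay needed for the contour integrals and,
along z = iy, total mass 1. -/
lemma norm_branch_mul_le {a : ℝ} (ha : |a| ≤ 1 / 10000) {z : ℂ} (hz : 0 ≤ z.im) :
    ‖branch a z * z + 1‖ ≤ 2 * ‖branch a z‖ ^ 2 := by
  have h := isRoot_branch ha hz
  have hn := h.norm_le ha
  have he : branch a z * z + 1 = -(branch a z ^ 2 + a * branch a z ^ 4) := by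
    linear_combination h.1
  rw [he, norm_neg]
  refine (norm_add_le _ _).trans ?_
  rw [norm_mul, norm_pow, norm_pow, Complex.norm_real, Real.norm_eq_abs]
  have h2 : ‖branch a z‖ ^ 2 ≤ 2 := by nlinarith [norm_nonneg (branch a z)]
  have h3 : |a| * ‖branch a z‖ ^ 4 ≤ 1 / 10000 * (2 * ‖branch a z‖ ^ 2) := by
    rw [show ‖branch a z‖ ^ 4 = ‖branch a z‖ ^ 2 * ‖branch a z‖ ^ 2 by ring]
    gcongr
  nlinarith [sq_nonneg ‖branch a z‖]

lemma norm_branch_le {a : ℝ} (ha : |a| ≤ 1 / 10000) {z : ℂ} (hz : 0 ≤ z.im) (h : 10 ≤ ‖z‖) :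
    ‖branch a z‖ ≤ 5 / ‖z‖ := by
  rw [le_div_iff₀ (by linarith)]
  have h1 := norm_branch_mul_le ha hz
  have hn := (isRoot_branch ha hz).norm_le ha
  have h2 : ‖branch a z * z‖ ≤ ‖branch a z * z + 1‖ + 1 := by
    simpa using norm_sub_le (branch a z * z + 1) 1
  rw [norm_mul] at h2
  nlinarith [norm_nonneg (branch a z)]

/-! ### Location of the spectral edge. -/

/-- The square of the positive critical point of `w ↦ 1/w + w + a w³`. -/
def critSq (a : ℝ) : ℝ := 2 / (1 + √(1 + 12 * a))

/-- The critical value of `w ↦ 1/w + w + a w³` on the positive half line. -/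
def edge (a : ℝ) : ℝ := √(critSq a) * (2 + 4 * a * critSq a)

/-- This is the vanishing of the derivative at r = √X. It also gives 1/r = r + 3ar³, which turns the
critical value 1/r + r + ar³ into the formula in `edge`. -/
lemma critSq_eq {a : ℝ} (ha : |a| ≤ 1 / 10000) : critSq a + 3 * a * critSq a ^ 2 = 1 := by
  have := abs_le.1 ha
  have h1 : √(1 + 12 * a) ^ 2 = 1 + 12 * a := Real.sq_sqrt (by linarith)
  have h2 : 1 + √(1 + 12 * a) ≠ 0 := by positivity
  unfold critSq
  field_simp
  linear_combination -h1

lemma critSq_bounds {a : ℝ} (ha : |a| ≤ 1 / 10000) :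
    0.999 ≤ critSq a ∧ critSq a ≤ 1.001 := by
  have := abs_le.1 ha
  have h1 : √(1 + 12 * a) ≤ 1.001 := by
    rw [Real.sqrt_le_left (by norm_num)]; nlinarith
  have h2 : 0.999 ≤ √(1 + 12 * a) := by
    apply Real.le_sqrt_of_sq_le; nlinarith
  unfold critSq
  constructor
  · rw [le_div_iff₀ (by linarith)]; nlinarith
  · rw [div_le_iff₀ (by linarith)]; nlinarith

lemma edge_sq {a : ℝ} (ha : |a| ≤ 1 / 10000) :
    edge a ^ 2 = critSq a * (2 + 4 * a * critSq a) ^ 2 := by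
  rw [edge, mul_pow, Real.sq_sqrt (by linarith [(critSq_bounds ha).1])]

/-- The function 1/r + r + ar³ equals 2 + a at r = 1. Its critical point is within O(|a|) of 1, so
the critical value differs from 2 + a only at second order. -/
lemma abs_edge_sub_le {a : ℝ} (ha : |a| ≤ 1 / 10000) :
    |edge a - (2 + a)| ≤ 11 * a ^ 2 := by
  have h1 := critSq_eq ha
  obtain ⟨h2, h3⟩ := critSq_bounds ha
  have hr := Real.sq_sqrt (show 0 ≤ critSq a by linarith)
  have hr0 := Real.sqrt_nonneg (critSq a)
  unfold edge
  set r := √(critSq a)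
  rw [← hr] at h1 h2 h3 ⊢
  have ha' := abs_le.1 ha
  have hr1 : r ≤ 1.001 := by nlinarith
  have h4 : r * (2 + 4 * a * r ^ 2) - (2 + a) =
      -((1 - r) ^ 2 * (1 + a * (1 + 2 * r + 3 * r ^ 2))) := by
    linear_combination h1
  have h5 : |a * (1 + 2 * r + 3 * r ^ 2)| ≤ 1 / 10000 * 10 := by
    rw [abs_mul]
    have : |1 + 2 * r + 3 * r ^ 2| ≤ 10 := by
      rw [abs_of_nonneg (by positivity)]; nlinarith
    gcongr
  have h6 := abs_le.1 h5
  have h7 : (1 - r) ^ 2 ≤ 10 * a ^ 2 := by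
    have e1 : (1 - r) * (1 + r) = 3 * a * (r ^ 2) ^ 2 := by linear_combination -h1
    have e2 : (1 - r) ^ 2 * (1 + r) ^ 2 = 9 * a ^ 2 * (r ^ 2) ^ 4 := by
      rw [← mul_pow, e1]; ring
    have e3 : (r ^ 2) ^ 4 ≤ 1.01 := by
      calc (r ^ 2) ^ 4 ≤ 1.001 ^ 4 := by gcongr
        _ ≤ 1.01 := by norm_num
    have e4 : (1 - r) ^ 2 ≤ (1 - r) ^ 2 * (1 + r) ^ 2 :=
      le_mul_of_one_le_right (sq_nonneg _) (by nlinarith)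
    nlinarith [sq_nonneg a]
  rw [h4, abs_neg, abs_of_nonneg (mul_nonneg (sq_nonneg _) (by linarith))]
  nlinarith [sq_nonneg (1 - r)]

lemma edge_bounds {a : ℝ} (ha : |a| ≤ 1 / 10000) : 1.99 ≤ edge a ∧ edge a ≤ 2.01 := by
  have h1 := abs_le.1 (abs_edge_sub_le ha)
  have h2 := abs_le.1 ha
  constructor <;> nlinarith

/-- For a ≥ 0 the critical value is at least 1/r + r ≥ 2. -/
lemma two_le_edge {a : ℝ} (ha : |a| ≤ 1 / 10000) (h0 : 0 ≤ a) : 2 ≤ edge a := by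
  have h1 := critSq_eq ha
  obtain ⟨h2, h3⟩ := critSq_bounds ha
  have hr := Real.sq_sqrt (show 0 ≤ critSq a by linarith)
  have hr0 : 0 < √(critSq a) := Real.sqrt_pos.2 (by linarith)
  unfold edge
  set r := √(critSq a)
  rw [← hr] at h1 ⊢
  refine le_of_mul_le_mul_right ?_ hr0
  have : 0 ≤ a * (r ^ 2) ^ 2 := by positivity
  nlinarith [sq_nonneg (r - 1)]

/-! ### Square-root behaviour at the edge. -/

/-- Criticality of L² makes y = X a double root of the left side. The identity is used over ℂ with y
= w², where the left side becomes (z² - L²) w², and over ℝ with y = |w|², hence the general ring. -/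
lemma edge_identity {R : Type*} [CommRing R] (a X y : R) (h : X + 3 * a * X ^ 2 = 1) :
    (1 + y + a * y ^ 2) ^ 2 - y * (X * (2 + 4 * a * X) ^ 2) =
      (y - X) ^ 2 * ((1 + 3 * a * X + a * y) ^ 2 - 4 * a ^ 2 * y * X) := by
  linear_combination (-2 * a * y ^ 2 - 2 * y - (X + 3 * a * X ^ 2 + 1)) * h

lemma kappa_add_bounds {L : ℝ} (hL : 1.99 ≤ L) (hL' : L ≤ 2.01) {z : ℂ} (hE : |z.re| ≤ 3)
    (h0 : 0 ≤ z.im) (h3 : z.im ≤ 3) :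
    (kappa L z.re + z.im) / 2 ≤ ‖z ^ 2 - (L : ℂ) ^ 2‖ ∧
      ‖z ^ 2 - (L : ℂ) ^ 2‖ ≤ 9 * (kappa L z.re + z.im) := by
  rw [show z ^ 2 - (L : ℂ) ^ 2 = (z + L) * (z - L) by ring, norm_mul]
  have a1 := Complex.abs_re_le_norm (z + L)
  have a2 := Complex.abs_im_le_norm (z + L)
  have a3 := Complex.norm_le_abs_re_add_abs_im (z + L)
  have b1 := Complex.abs_re_le_norm (z - L)
  have b2 := Complex.abs_im_le_norm (z - L)
  have b3 := Complex.norm_le_abs_re_add_abs_im (z - L)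
  simp only [Complex.add_re, Complex.sub_re, Complex.add_im, Complex.sub_im, Complex.ofReal_re,
    Complex.ofReal_im, add_zero, sub_zero, abs_of_nonneg h0] at a1 a2 a3 b1 b2 b3
  obtain ⟨e1, e2⟩ := abs_le.1 hE
  have n1 := abs_nonneg (z.re + L)
  have n2 := abs_nonneg (z.re - L)
  unfold kappa
  rcases le_total 0 z.re with h | h
  · have c1 : |z.re + L| = z.re + L := abs_of_nonneg (by linarith)
    have c2 : |z.re - L| ≤ |z.re + L| := by
      rw [c1, abs_le]; constructor <;> linarith
    rw [min_eq_right c2]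
    constructor <;> nlinarith
  · have c1 : |z.re - L| = L - z.re := by rw [abs_of_nonpos (by linarith)]; ring
    have c2 : |z.re + L| ≤ |z.re - L| := by
      rw [c1, abs_le]; constructor <;> linarith
    rw [min_eq_left c2]
    constructor <;> nlinarith

lemma kappa_nonneg (L E : ℝ) : 0 ≤ kappa L E := le_min (abs_nonneg _) (abs_nonneg _)

/-- `|w² - w₀²|` is comparable to `Im w` plus the defect of `w`. -/
lemma norm_sq_sub_critSq_bounds {a : ℝ} (ha : |a| ≤ 1 / 10000) {w : ℂ} (hi : 0 ≤ w.im)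
    (hD : 0 ≤ defect a w) (hp : 1 / 25 ≤ w.re ^ 2 + w.im ^ 2) (hp' : w.re ^ 2 + w.im ^ 2 ≤ 1.01) :
    ‖w ^ 2 - critSq a‖ ≤ 5 * (defect a w + w.im) ∧
      defect a w + w.im ≤ 6 * ‖w ^ 2 - critSq a‖ := by
  obtain ⟨X1, X2⟩ := critSq_bounds ha
  have hX := critSq_eq ha
  set X := critSq a
  have hN : ‖w ^ 2 - X‖ ^ 2 =
      (X - (w.re ^ 2 + w.im ^ 2) + 2 * w.im ^ 2) ^ 2 + 4 * w.re ^ 2 * w.im ^ 2 := by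
    rw [sq_norm_eq]
    simp [pow_two]
    ring
  have hN0 := norm_nonneg (w ^ 2 - (X : ℂ))
  have hDd : defect a w = (X - (w.re ^ 2 + w.im ^ 2)) * (1 + 3 * a * (X + (w.re ^ 2 + w.im ^ 2))) +
      4 * a * (w.re ^ 2 + w.im ^ 2) * w.im ^ 2 := by
    unfold defect
    linear_combination -hX
  set D := defect a w
  set N := ‖w ^ 2 - (X : ℂ)‖
  set p := w.re ^ 2 + w.im ^ 2 with hpdef
  set v := w.im
  set u := w.re
  obtain ⟨a1, a2⟩ := abs_le.1 ha
  have hv2 : v ^ 2 ≤ 1.01 := by nlinarith [sq_nonneg u]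
  have hv1 : v ≤ 1.01 := by nlinarith
  have hu1 : |u| ≤ 1.01 := by
    rw [abs_le]; constructor <;> nlinarith [sq_nonneg v]
  set c := 1 + 3 * a * (X + p) with hc
  have hc1 : 0.999 ≤ c := by nlinarith
  have hc2 : c ≤ 1.001 := by nlinarith
  have hap1 : -0.001 ≤ 4 * a * p := by nlinarith
  have hap2 : 4 * a * p ≤ 0.001 := by nlinarith
  set q := 4 * a * p
  -- A is X - Re w², so N² = A² + (Im w²)². It is nonnegative because D is, and comparable to D +
  -- v².
  set A := X - p + 2 * v ^ 2 with hA
  have hcA : c * A = D + (2 * c - q) * v ^ 2 := by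
    rw [hDd, hA]; ring
  have hv0 := sq_nonneg v
  have hA0 : 0 ≤ A := by
    have : 0 ≤ c * A := by
      rw [hcA]
      exact add_nonneg hD (mul_nonneg (by linarith) hv0)
    exact nonneg_of_mul_nonneg_right this (by linarith)
  have hA1 : D + 1.9 * v ^ 2 ≤ 1.001 * A := by
    have e1 := mul_le_mul_of_nonneg_right hc2 hA0
    have e2 := mul_le_mul_of_nonneg_right (show 1.9 ≤ 2 * c - q by linarith) hv0
    linarith
  have hA2 : 0.999 * A ≤ D + 2.1 * v ^ 2 := by
    have e1 := mul_le_mul_of_nonneg_right hc1 hA0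
    have e2 := mul_le_mul_of_nonneg_right (show 2 * c - q ≤ 2.1 by linarith) hv0
    linarith
  constructor
  · refine abs_le_of_sq_le_sq' ?_ (by positivity) |>.2
    rw [hN]
    have h0 : v ^ 2 ≤ 1.01 * v := by
      rw [sq]
      exact mul_le_mul_of_nonneg_right hv1 hi
    have h1 : A ≤ 1.1 * D + 2.5 * v := by linarith
    have h2 : (2 * |u| * v) ^ 2 = 4 * u ^ 2 * v ^ 2 := by
      rw [mul_pow, mul_pow, sq_abs]; ring
    have h3 : 2 * |u| * v ≤ 2.1 * v := mul_le_mul_of_nonneg_right (by linarith) hi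
    have h4 : 0 ≤ 2 * |u| * v := by positivity
    rw [← h2]
    calc A ^ 2 + (2 * |u| * v) ^ 2 ≤ (A + 2 * |u| * v) ^ 2 := by
          have := mul_nonneg hA0 h4
          linarith [add_sq A (2 * |u| * v)]
      _ ≤ (5 * (D + v)) ^ 2 := by
        apply pow_le_pow_left₀ (by positivity)
        linarith
  · have hAN : A ≤ N := by
      refine abs_le_of_sq_le_sq' ?_ hN0 |>.2
      rw [hN]
      have : 0 ≤ 4 * u ^ 2 * v ^ 2 := by positivity
      linarith
    -- The term 4u²v² loses control of v when u is small; there v² ≤ 0.6 N takes over. The bound p ≥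
    -- 1/25 says that u and v are not both small.
    have hvN : v ≤ 4 * N := by
      refine abs_le_of_sq_le_sq' ?_ (by positivity) |>.2
      have h1 : v ^ 2 * p = u ^ 2 * v ^ 2 + v ^ 2 * v ^ 2 := by rw [hpdef]; ring
      have h2 : v ^ 2 ≤ 0.6 * N := by linarith
      have h3 : v ^ 2 * v ^ 2 ≤ 0.6 * N * (0.6 * N) := by gcongr
      have h4 : u ^ 2 * v ^ 2 ≤ N ^ 2 / 4 := by linarith [sq_nonneg A]
      have h5 := mul_le_mul_of_nonneg_left hp hv0
      linarith
    have hv2' : 0 ≤ 1.9 * v ^ 2 := by positivity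
    linarith

/-- On this region |z| ≤ 4.25, so a smaller w would leave zw + w² + aw⁴ with modulus below 1. -/
lemma one_div_five_le_norm {a : ℝ} (ha : |a| ≤ 1 / 10000) {z w : ℂ} (h : IsRoot a z w)
    (hE : |z.re| ≤ 3) (h0 : 0 ≤ z.im) (h3 : z.im ≤ 3) : 1 / 5 ≤ ‖w‖ := by
  by_contra! hlt
  have hz : ‖z‖ ≤ 4.25 := by
    refine abs_le_of_sq_le_sq' ?_ (by norm_num) |>.2
    rw [sq_norm_eq]
    have := abs_le.1 hE
    nlinarith
  have h1 : (1 : ℂ) = -(z * w + w ^ 2 + a * w ^ 4) := by linear_combination h.1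
  have h2 := congrArg norm h1
  rw [norm_one, norm_neg] at h2
  have h4 := norm_add_le (z * w + w ^ 2) (a * w ^ 4)
  have h5 := norm_add_le (z * w) (w ^ 2)
  rw [norm_mul, norm_pow, Complex.norm_real, Real.norm_eq_abs] at h4
  rw [norm_mul, norm_pow] at h5
  have n := norm_nonneg w
  have h6 : ‖z‖ * ‖w‖ ≤ 4.25 * (1 / 5) := by gcongr
  have h7 : ‖w‖ ^ 2 ≤ (1 / 5) ^ 2 := by gcongr
  have h8 : |a| * ‖w‖ ^ 4 ≤ 1 / 10000 * (1 / 5) ^ 4 := by gcongr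
  norm_num at h6 h7 h8
  linarith

/-- The square root behaviour: `√(κ + η)` is comparable to `Im w` plus the defect of `w`. -/
lemma sqrt_kappa_bounds {a : ℝ} (ha : |a| ≤ 1 / 10000) {z w : ℂ} (h : IsRoot a z w)
    (hE : |z.re| ≤ 3) (h0 : 0 ≤ z.im) (h3 : z.im ≤ 3) :
    √(kappa (edge a) z.re + z.im) ≤ 40 * (defect a w + w.im) ∧
      defect a w + w.im ≤ 24 * √(kappa (edge a) z.re + z.im) := by
  have hp' := h.normSq_le ha
  have hn := one_div_five_le_norm ha h hE h0 h3
  have hp : 1 / 25 ≤ w.re ^ 2 + w.im ^ 2 := by rw [← sq_norm_eq]; nlinarith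
  obtain ⟨N1, N2⟩ := norm_sq_sub_critSq_bounds ha h.2.1 h.2.2.2 hp hp'
  obtain ⟨L1, L2⟩ := edge_bounds ha
  obtain ⟨K1, K2⟩ := kappa_add_bounds L1 L2 hE h0 h3
  obtain ⟨X1, X2⟩ := critSq_bounds ha
  have hX := critSq_eq ha
  have hL := edge_sq ha
  have hT0 : 0 ≤ kappa (edge a) z.re + z.im := add_nonneg (kappa_nonneg _ _) h0
  have hT := Real.sq_sqrt hT0
  have hT1 := Real.sqrt_nonneg (kappa (edge a) z.re + z.im)
  set T := √(kappa (edge a) z.re + z.im)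
  rw [← hT] at K1 K2
  have hN0 := norm_nonneg (w ^ 2 - (critSq a : ℂ))
  set X := critSq a
  have hXc : (X : ℂ) + 3 * a * (X : ℂ) ^ 2 = 1 := by exact_mod_cast congrArg Complex.ofReal hX
  have hLc : (edge a : ℂ) ^ 2 = X * (2 + 4 * a * X) ^ 2 := by exact_mod_cast congrArg Complex.ofReal hL
  set M : ℂ := (1 + 3 * a * X + a * w ^ 2) ^ 2 - 4 * a ^ 2 * w ^ 2 * X with hM
  have hid : (z ^ 2 - (edge a : ℂ) ^ 2) * w ^ 2 = (w ^ 2 - X) ^ 2 * M := by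
    rw [hM, ← edge_identity (a : ℂ) X (w ^ 2) hXc, hLc]
    linear_combination (z * w - (1 + w ^ 2 + a * w ^ 4)) * h.1
  have hid2 := congrArg norm hid
  rw [norm_mul, norm_mul, norm_pow, norm_pow, sq_norm_eq w] at hid2
  have hMn : ‖M - 1‖ ≤ 0.01 := by
    have hwn := sq_norm_eq w
    have e1 : ‖(3 * a * X + a * w ^ 2 : ℂ)‖ ≤ 0.001 := by
      refine (norm_add_le _ _).trans ?_
      simp only [norm_mul, norm_pow, Complex.norm_real, Real.norm_eq_abs, Complex.norm_ofNat, hwn]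
      rw [abs_of_nonneg (show 0 ≤ X by linarith)]
      nlinarith [abs_nonneg a]
    have e2 : ‖(4 * a ^ 2 * w ^ 2 * X : ℂ)‖ ≤ 0.001 := by
      simp only [norm_mul, norm_pow, Complex.norm_real, Real.norm_eq_abs, Complex.norm_ofNat, hwn]
      rw [abs_of_nonneg (show 0 ≤ X by linarith)]
      calc 4 * |a| ^ 2 * (w.re ^ 2 + w.im ^ 2) * X ≤ 4 * (1 / 10000) ^ 2 * 1.01 * 1.001 := by gcongr
        _ ≤ _ := by norm_num
    have e3 : M - 1 = 2 * (3 * a * X + a * w ^ 2) + (3 * a * X + a * w ^ 2) ^ 2 -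
        4 * a ^ 2 * w ^ 2 * X := by rw [hM]; ring
    rw [e3]
    refine (norm_sub_le _ _).trans ?_
    have e4 := norm_add_le (2 * (3 * a * X + a * w ^ 2) : ℂ) ((3 * a * X + a * w ^ 2) ^ 2)
    rw [norm_mul, norm_pow, Complex.norm_ofNat] at e4
    nlinarith [norm_nonneg (3 * a * X + a * w ^ 2 : ℂ)]
  have hM1 : ‖M‖ ≤ 1.01 := by
    have := norm_add_le (M - 1) 1
    rw [sub_add_cancel, norm_one] at this
    linarith
  have hM2 : 0.99 ≤ ‖M‖ := by
    have := norm_sub_le M (M - 1)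
    rw [sub_sub_cancel, norm_one] at this
    linarith
  set N := ‖w ^ 2 - (X : ℂ)‖
  set Q := ‖z ^ 2 - (edge a : ℂ) ^ 2‖
  set p := w.re ^ 2 + w.im ^ 2
  have hN2 := sq_nonneg N
  have hQ0 : 0 ≤ Q := norm_nonneg _
  have hTN : T ≤ 8 * N := by
    refine abs_le_of_sq_le_sq' ?_ (by positivity) |>.2
    nlinarith
  have hNT : N ≤ 4 * T := by
    refine abs_le_of_sq_le_sq' ?_ (by positivity) |>.2
    have h1 : 0.99 * N ^ 2 ≤ Q * p := by rw [hid2]; nlinarith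
    have h2 : Q * p ≤ 9 * T ^ 2 * 1.01 := by gcongr
    nlinarith
  constructor <;> linarith

set_option maxHeartbeats 1000000 in
/-- Comparison of `Re z` with the edge decides which of `Im w` and the defect dominates. -/
lemma inside_outside {a : ℝ} (ha : |a| ≤ 1 / 10000) {z w : ℂ} (h : IsRoot a z w)
    (hp : 1 / 25 ≤ w.re ^ 2 + w.im ^ 2) :
    (z.re ^ 2 ≤ edge a ^ 2 → defect a w ≤ 13 * w.im) ∧
      (edge a ^ 2 ≤ z.re ^ 2 → w.im ≤ 2 * defect a w) := by
  have hp' := h.normSq_le ha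
  have hre := (re_im_of_eq h.1).2
  have hi := h.2.1
  have hD : 0 ≤ defect a w := h.2.2.2
  obtain ⟨X1, X2⟩ := critSq_bounds ha
  have hX := critSq_eq ha
  have hL := edge_sq ha
  set X := critSq a
  have hDd : defect a w = (X - (w.re ^ 2 + w.im ^ 2)) * (1 + 3 * a * (X + (w.re ^ 2 + w.im ^ 2))) +
      4 * a * (w.re ^ 2 + w.im ^ 2) * w.im ^ 2 := by
    unfold defect
    linear_combination -hX
  set D := defect a w
  have hid := edge_identity a X (w.re ^ 2 + w.im ^ 2) hX
  rw [← hL] at hid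
  set p := w.re ^ 2 + w.im ^ 2 with hpdef
  set v := w.im
  set u := w.re
  set E := z.re
  set L := edge a
  have hu : u ^ 2 = p - v ^ 2 := by rw [hpdef]; ring
  obtain ⟨a1, a2⟩ := abs_le.1 ha
  have hv2 : v ^ 2 ≤ 1.01 := by linarith [sq_nonneg u]
  have hv20 := sq_nonneg v
  have hv1 : v ≤ 1.01 := abs_le_of_sq_le_sq' (by linarith) (by norm_num) |>.2
  set B := 1 + p + a * p ^ 2 with hB
  set M := (1 + 3 * a * X + a * p) ^ 2 - 4 * a ^ 2 * p * X with hM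
  have hp0 : 0 ≤ p := by linarith
  have hX0 : 0 ≤ X := by linarith
  have hmul : ∀ {x b : ℝ}, 0 ≤ x → x ≤ b → |a * x| ≤ 1 / 10000 * b := by
    intro x b hx hb
    rw [abs_mul, abs_of_nonneg hx]
    gcongr
  have hp2 : p ^ 2 ≤ 1.1 := by
    calc p ^ 2 ≤ 1.01 ^ 2 := by gcongr
      _ ≤ 1.1 := by norm_num
  have hap := abs_le.1 (hmul hp0 hp')
  have haX := abs_le.1 (hmul hX0 X2)
  have happ := abs_le.1 (hmul (sq_nonneg p) hp2)
  have hB1 : 1 ≤ B := by linarith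
  have hB2 : B ≤ 2.1 := by linarith
  have hB4 : B ^ 2 ≤ 4.41 := by
    calc B ^ 2 ≤ 2.1 ^ 2 := by gcongr
      _ ≤ 4.41 := by norm_num
  have hB5 : 1 ≤ B ^ 2 := one_le_pow₀ hB1
  have haa : a ^ 2 ≤ 1 / 10 ^ 8 := by
    calc a ^ 2 = |a| ^ 2 := (sq_abs a).symm
      _ ≤ (1 / 10000) ^ 2 := by gcongr
      _ = _ := by norm_num
  have hpX : p * X ≤ 1.02 := by
    calc p * X ≤ 1.01 * 1.001 := by gcongr
      _ ≤ _ := by norm_num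
  have hpX0 : 0 ≤ p * X := by positivity
  have hM1 : 0.9 ≤ M := by
    have : 4 * a ^ 2 * (p * X) ≤ 4 * (1 / 10 ^ 8) * 1.02 := by gcongr
    have h2 : (0.99 : ℝ) ^ 2 ≤ (1 + 3 * a * X + a * p) ^ 2 := by gcongr; linarith
    norm_num at this h2
    linarith
  have hM2 : M ≤ 1.1 := by
    have : 0 ≤ 4 * a ^ 2 * (p * X) := by positivity
    have h2 : (1 + 3 * a * X + a * p) ^ 2 ≤ (1.01 : ℝ) ^ 2 := by
      apply pow_le_pow_left₀ <;> linarith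
    norm_num at h2
    linarith
  set G := (p - v ^ 2) * (8 * a * p * B - 16 * a ^ 2 * p ^ 2 * v ^ 2) with hG
  have hGb : |G| ≤ 0.1 := by
    rw [hG, abs_mul, ← hu, abs_of_nonneg (sq_nonneg u)]
    have h1 : |8 * a * p * B - 16 * a ^ 2 * p ^ 2 * v ^ 2| ≤ 0.05 := by
      have e0 : 0 ≤ p * B := by positivity
      have e1 : p * B ≤ 2.2 := by
        calc p * B ≤ 1.01 * 2.1 := by gcongr
          _ ≤ _ := by norm_num
      have e4 := abs_le.1 (hmul e0 e1)
      have e2 : a ^ 2 * (p ^ 2 * v ^ 2) ≤ 1 / 10 ^ 8 * (1.1 * 1.01) := by gcongr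
      have e3 : 0 ≤ a ^ 2 * (p ^ 2 * v ^ 2) := by positivity
      norm_num at e2
      rw [abs_le]; constructor <;> linarith
    calc u ^ 2 * |8 * a * p * B - 16 * a ^ 2 * p ^ 2 * v ^ 2| ≤ 1.01 * 0.05 := by
          gcongr; linarith
      _ ≤ 0.1 := by norm_num
  have hGb' := abs_le.1 hGb
  -- `edge_identity` at y = p = |w|² is combined with the formula for Re z; G collects the
  -- corrections of order a. As M is near 1 and B² + G is bounded above and below, the sign of L² -
  -- E² compares v with |X - p|, and D equals (X - p)c up to 0.01 v.
  have hkey : p ^ 2 * (L ^ 2 - E ^ 2) = v ^ 2 * (B ^ 2 + G) - p * ((X - p) ^ 2 * M) := by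
    have h1 : (E * p) ^ 2 = (p - v ^ 2) * (B - 4 * a * p * v ^ 2) ^ 2 := by
      rw [hre, ← hu, hB]
      linear_combination u ^ 2 * (2 * (1 + p) + a * p * (u ^ 2 - 3 * v ^ 2) +
        a * p * (p - 4 * v ^ 2)) * (a * p) * hu
    rw [hG]
    linear_combination -h1 - p * hid
  set d := X - p
  set c := 1 + 3 * a * (X + p) with hc
  have hc1 : 0.999 ≤ c := by linarith
  have hc2 : c ≤ 1.001 := by linarith
  have hap1 : -0.001 ≤ 4 * a * p := by linarith
  have hap2 : 4 * a * p ≤ 0.001 := by linarith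
  have hqv : |4 * a * p * v ^ 2| ≤ 0.01 * v := by
    rw [abs_mul, abs_of_nonneg hv20]
    have : |4 * a * p| ≤ 0.001 := abs_le.2 ⟨hap1, hap2⟩
    calc |4 * a * p| * v ^ 2 ≤ 0.001 * v ^ 2 := by gcongr
      _ ≤ 0.01 * v := by
        have := mul_le_mul_of_nonneg_right hv1 hi
        linarith [sq v]
  have hqv' := abs_le.1 hqv
  have hd2 := sq_nonneg d
  constructor
  · intro hle
    have h1 : p * (d ^ 2 * M) ≤ v ^ 2 * (B ^ 2 + G) := by
      have : 0 ≤ p ^ 2 * (L ^ 2 - E ^ 2) := mul_nonneg (sq_nonneg _) (by linarith)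
      linarith
    have h2 : 1 / 25 * (d ^ 2 * 0.9) ≤ p * (d ^ 2 * M) := by gcongr
    have h3 : v ^ 2 * (B ^ 2 + G) ≤ v ^ 2 * 5 := by gcongr; linarith
    have h4 : d ≤ 12 * v := by
      refine abs_le_of_sq_le_sq' ?_ (by positivity) |>.2
      linarith
    have h5 : d * c ≤ 12 * v * 1.001 := by
      calc d * c ≤ 12 * v * c := by gcongr
        _ ≤ _ := by gcongr
    rw [hDd]
    linarith
  · intro hle
    have h1 : v ^ 2 * (B ^ 2 + G) ≤ p * (d ^ 2 * M) := by
      have : p ^ 2 * (L ^ 2 - E ^ 2) ≤ 0 :=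
        mul_nonpos_of_nonneg_of_nonpos (sq_nonneg _) (by linarith)
      linarith
    have h2 : v ^ 2 * 0.9 ≤ v ^ 2 * (B ^ 2 + G) := by gcongr; linarith
    have h3 : p * (d ^ 2 * M) ≤ 1.01 * (d ^ 2 * 1.1) := by gcongr
    have h4 : v ^ 2 ≤ (1.2 * |d|) ^ 2 := by rw [mul_pow, sq_abs]; linarith
    have h5 : v ≤ 1.2 * |d| := abs_le_of_sq_le_sq' h4 (by positivity) |>.2
    have h6 : d * c = D - 4 * a * p * v ^ 2 := by rw [hDd]; ring
    have h7 : |d| * 0.999 ≤ D + 0.01 * v := by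
      calc |d| * 0.999 ≤ |d| * c := by gcongr
        _ = |d * c| := by rw [abs_mul, abs_of_nonneg (show 0 ≤ c by linarith)]
        _ ≤ D + 0.01 * v := by
          rw [h6, abs_le]; constructor <;> linarith
    linarith

/-! ### Stieltjes inversion by contour integration. -/

open Topology Filter Complex in
/-- If `g` is holomorphic on the upper half plane, continuous up to the real line, and decays
quadratically, then its integral over the real line vanishes. -/
lemma tendsto_integral_zero_of_decay {g : ℂ → ℂ} (hc : ContinuousOn g {z | 0 ≤ z.im})
    (hd : DifferentiableOn ℂ g {z | 0 < z.im}) {B R₀ : ℝ}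
    (hB : ∀ z : ℂ, 0 ≤ z.im → R₀ ≤ ‖z‖ → ‖g z‖ ≤ B / ‖z‖ ^ 2) :
    Tendsto (fun R : ℝ => ∫ x in (-R)..R, g x) atTop (𝓝 0) := by
  have hlim : Tendsto (fun R : ℝ => 4 * |B| / R) atTop (𝓝 0) :=
    tendsto_const_nhds.div_atTop tendsto_id
  refine squeeze_zero_norm' ?_ hlim
  filter_upwards [eventually_ge_atTop R₀, eventually_gt_atTop 0] with R hR hR0
  -- Rectangle [-R, R] × [0, R]: the three sides off the real line have total length 4R and the
  -- integrand there is at most |B|/R².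
  have hrect := integral_boundary_rect_eq_zero_of_continuousOn_of_differentiableOn g
    (⟨-R, 0⟩ : ℂ) (⟨R, R⟩ : ℂ) ?_ ?_
  rotate_left
  · refine hc.mono ?_
    rintro z ⟨-, hz⟩
    rw [Set.mem_preimage, Set.uIcc_of_le hR0.le] at hz
    exact hz.1
  · refine hd.mono ?_
    rintro z ⟨-, hz⟩
    rw [Set.mem_preimage, min_eq_left hR0.le] at hz
    exact hz.1
  have hbd : ∀ z : ℂ, 0 ≤ z.im → R ≤ ‖z‖ → ‖g z‖ ≤ |B| / R ^ 2 := by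
    intro z hz hz'
    refine (hB z hz (hR.trans hz')).trans ?_
    gcongr
    exact le_abs_self B
  have h1 : ‖∫ x : ℝ in (-R)..R, g (x + (R : ℝ) * I)‖ ≤ |B| / R ^ 2 * |R - (-R)| := by
    refine intervalIntegral.norm_integral_le_of_norm_le_const fun x _ => hbd _ ?_ ?_
    · simpa using hR0.le
    · have := Complex.abs_im_le_norm (x + (R : ℝ) * I)
      simp at this
      exact (le_abs_self R).trans this
  have h2 : ‖∫ y : ℝ in (0 : ℝ)..R, g ((R : ℝ) + y * I)‖ ≤ |B| / R ^ 2 * |R - 0| := by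
    refine intervalIntegral.norm_integral_le_of_norm_le_const fun y hy => hbd _ ?_ ?_
    · rw [Set.uIoc_of_le hR0.le] at hy
      simpa using hy.1.le
    · have := Complex.abs_re_le_norm ((R : ℝ) + y * I)
      simp at this
      exact (le_abs_self R).trans this
  have h3 : ‖∫ y : ℝ in (0 : ℝ)..R, g (((-R : ℝ) : ℂ) + y * I)‖ ≤ |B| / R ^ 2 * |R - 0| := by
    refine intervalIntegral.norm_integral_le_of_norm_le_const fun y hy => hbd _ ?_ ?_
    · rw [Set.uIoc_of_le hR0.le] at hy
      simpa using hy.1.le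
    · have := Complex.abs_re_le_norm (((-R : ℝ) : ℂ) + y * I)
      simp at this
      exact (le_abs_self R).trans (by simpa using this)
  simp only [ofReal_zero, zero_mul, add_zero, smul_eq_mul] at hrect
  have he : ∫ x in (-R)..R, g x = (∫ x : ℝ in (-R)..R, g (x + (R : ℝ) * I)) -
      I * (∫ y : ℝ in (0 : ℝ)..R, g ((R : ℝ) + y * I)) +
      I * (∫ y : ℝ in (0 : ℝ)..R, g (((-R : ℝ) : ℂ) + y * I)) := by
    linear_combination hrect
  rw [he]
  refine (norm_add_le _ _).trans ?_
  have h4 := norm_sub_le (∫ x : ℝ in (-R)..R, g (x + (R : ℝ) * I))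
    (I * (∫ y : ℝ in (0 : ℝ)..R, g ((R : ℝ) + y * I)))
  rw [norm_mul, norm_I, one_mul] at h4 ⊢
  rw [abs_of_pos (show 0 < R - -R by linarith)] at h1
  rw [abs_of_pos (show 0 < R - 0 by linarith)] at h2 h3
  have h5 : 4 * |B| / R = |B| / R ^ 2 * (R - -R) + |B| / R ^ 2 * (R - 0) + |B| / R ^ 2 * (R - 0) := by
    field_simp
    ring
  linarith

lemma integral_inv_sq_add_sq {η : ℝ} (hη : 0 < η) (E : ℝ) :
    Integrable (fun x : ℝ => ((x - E) ^ 2 + η ^ 2)⁻¹) ∧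
    ∫ x : ℝ, ((x - E) ^ 2 + η ^ 2)⁻¹ = Real.pi / η := by
  have he : ∀ x : ℝ, (x ^ 2 + η ^ 2)⁻¹ = (η ^ 2)⁻¹ * (1 + (x / η) ^ 2)⁻¹ := by
    intro x
    rw [← mul_inv]
    congr 1
    field_simp
    ring
  constructor
  · have : Integrable (fun x : ℝ => (x ^ 2 + η ^ 2)⁻¹) := by
      simp_rw [he]
      exact (integrable_inv_one_add_sq.comp_div hη.ne').const_mul _
    exact this.comp_sub_right E
  · rw [integral_sub_right_eq_self (fun x : ℝ => (x ^ 2 + η ^ 2)⁻¹) E]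
    simp_rw [he]
    rw [integral_const_mul, Measure.integral_comp_div (fun x : ℝ => (1 + x ^ 2)⁻¹) η,
      integral_univ_inv_one_add_sq, abs_of_pos hη, smul_eq_mul]
    field_simp

open Topology Filter Complex in
/-- A holomorphic function on the upper half plane, continuous up to the real line and decaying at
infinity, is the Stieltjes transform of its boundary imaginary part. -/
lemma integral_im_mul_inv_eq {m : ℂ → ℂ} (hc : ContinuousOn m {z | 0 ≤ z.im})
    (hd : DifferentiableOn ℂ m {z | 0 < z.im}) {B R₀ : ℝ} (hR₀ : 0 < R₀)
    (hB : ∀ z : ℂ, 0 ≤ z.im → R₀ ≤ ‖z‖ → ‖m z‖ ≤ B / ‖z‖)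
    {z : ℂ} (hz : 0 < z.im)
    (hint : Integrable (fun x : ℝ => ((m x).im : ℂ) * ((x : ℂ) - z)⁻¹)) :
    ∫ x : ℝ, ((m x).im : ℂ) * ((x : ℂ) - z)⁻¹ = Real.pi * m z := by
  set zb : ℂ := (starRingEnd ℂ) z with hzb
  have hzbi : zb.im = -z.im := by simp [hzb]
  have hne : ∀ ζ : ℂ, 0 ≤ ζ.im → ζ - zb ≠ 0 := by
    intro ζ hζ h0
    have := congrArg Complex.im h0
    rw [sub_im, hzbi] at this
    simp at this
    linarith
  have hnex : ∀ x : ℝ, (x : ℂ) - z ≠ 0 := by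
    intro x h0
    have := congrArg Complex.im h0
    simp at this
    linarith
  have hopenH : IsOpen {z : ℂ | 0 < z.im} := isOpen_lt continuous_const Complex.continuous_im
  -- The subtracted term has its pole at z̄ and equals m(z) at ζ = z. Hence F(ζ)/(ζ - z) extends
  -- holomorphically to the half plane and decays quadratically, and Cauchy's theorem suffices
  -- without residues.
  set F : ℂ → ℂ := fun ζ => m ζ - m z * ((z - zb) / (ζ - zb)) with hF
  have hFz : F z = 0 := by
    simp only [hF]
    rw [div_self (hne z hz.le)]
    ring
  have hFc : ContinuousOn F {z | 0 ≤ z.im} := by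
    refine hc.sub (continuousOn_const.mul (continuousOn_const.div (by fun_prop) ?_))
    exact fun ζ hζ => hne ζ hζ
  have hFd : DifferentiableOn ℂ F {z | 0 < z.im} := by
    refine hd.sub ((differentiableOn_const _).mul ((differentiableOn_const _).div (by fun_prop) ?_))
    exact fun ζ hζ => hne ζ (le_of_lt hζ)
  have hnhds : {z : ℂ | 0 < z.im} ∈ 𝓝 z := hopenH.mem_nhds hz
  have hnhds' : {z : ℂ | 0 ≤ z.im} ∈ 𝓝 z :=
    mem_of_superset hnhds fun x (hx : 0 < x.im) => show 0 ≤ x.im from hx.le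
  set R₁ : ℝ := max R₀ (2 * ‖z‖) with hR₁
  have hfar : ∀ ζ : ℂ, R₁ ≤ ‖ζ‖ → ‖ζ‖ / 2 ≤ ‖ζ - z‖ ∧ ‖ζ‖ / 2 ≤ ‖ζ - zb‖ ∧ R₀ ≤ ‖ζ‖ := by
    intro ζ hζ
    have h1 : R₀ ≤ ‖ζ‖ := (le_max_left _ _).trans hζ
    have h2 : 2 * ‖z‖ ≤ ‖ζ‖ := (le_max_right _ _).trans hζ
    have h3 := norm_sub_norm_le ζ z
    have h4 := norm_sub_norm_le ζ zb
    have h5 : ‖zb‖ = ‖z‖ := by simp [hzb]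
    refine ⟨?_, ?_, h1⟩ <;> linarith
  have hinv : ∀ u ζ : ℂ, 0 < ‖ζ‖ → ‖ζ‖ / 2 ≤ ‖ζ - u‖ → ‖ζ - u‖⁻¹ ≤ 2 / ‖ζ‖ := by
    intro u ζ h0 h
    rw [show 2 / ‖ζ‖ = (‖ζ‖ / 2)⁻¹ by rw [inv_div]]
    exact inv_anti₀ (by linarith) h
  -- the two contour integrals
  have lim1 : Tendsto (fun R : ℝ => ∫ x in (-R)..R, dslope F z x) atTop (𝓝 0) := by
    refine tendsto_integral_zero_of_decay (R₀ := R₁) (B := (B + ‖m z‖ * (‖z - zb‖ * 2)) * 2) ?_ ?_ ?_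
    · rw [continuousOn_dslope hnhds']
      exact ⟨hFc, (hFd z hz).differentiableAt hnhds⟩
    · rw [differentiableOn_dslope hnhds]
      exact hFd
    · intro ζ hζ hζR
      obtain ⟨h1, h2, h3⟩ := hfar ζ hζR
      have h0 : 0 < ‖ζ‖ := hR₀.trans_le h3
      have hζz : ζ ≠ z := by
        rintro rfl
        rw [sub_self, norm_zero] at h1
        linarith
      rw [dslope_of_ne _ hζz, slope_def_field, hFz, sub_zero, norm_div, div_eq_mul_inv]
      have hFb : ‖F ζ‖ ≤ (B + ‖m z‖ * (‖z - zb‖ * 2)) / ‖ζ‖ := by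
        refine (norm_sub_le _ _).trans ?_
        rw [norm_mul, norm_div, add_div]
        refine add_le_add (hB ζ hζ h3) ?_
        rw [mul_div_assoc, mul_div_assoc, div_eq_mul_inv]
        have := hinv zb ζ h0 h2
        gcongr
      calc _ ≤ (B + ‖m z‖ * (‖z - zb‖ * 2)) / ‖ζ‖ * (2 / ‖ζ‖) := by
            have := hinv z ζ h0 h1
            have h4 := (norm_nonneg _).trans hFb
            gcongr
        _ = _ := by rw [div_mul_div_comm, sq]
  -- Here the pole z̄ is outside the half plane. Conjugation on the real line turns this into the
  -- vanishing of the integral of m̄/(x - z).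
  have lim2 : Tendsto (fun R : ℝ => ∫ x in (-R)..R, m x / (x - zb)) atTop (𝓝 0) := by
    refine tendsto_integral_zero_of_decay (g := fun ζ => m ζ / (ζ - zb)) (R₀ := R₁) (B := B * 2) ?_ ?_ ?_
    · exact hc.div (by fun_prop) fun ζ hζ => hne ζ hζ
    · exact hd.div (by fun_prop) fun ζ hζ => hne ζ (le_of_lt hζ)
    · intro ζ hζ hζR
      obtain ⟨h1, h2, h3⟩ := hfar ζ hζR
      have h0 : 0 < ‖ζ‖ := hR₀.trans_le h3
      rw [norm_div, div_eq_mul_inv]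
      calc _ ≤ B / ‖ζ‖ * (2 / ‖ζ‖) := by
            have := hinv zb ζ h0 h2
            have h4 := hB ζ hζ h3
            have h5 := (norm_nonneg _).trans h4
            gcongr
        _ = _ := by rw [div_mul_div_comm, sq]
  have hcx : Continuous fun x : ℝ => m x :=
    hc.comp_continuous continuous_ofReal fun x => by simp
  have lim3 : Tendsto (fun R : ℝ => ∫ x in (-R)..R, (starRingEnd ℂ) (m x / (x - zb))) atTop (𝓝 0) := by
    have := (continuous_conj.tendsto 0).comp lim2
    rw [map_zero] at this
    refine this.congr fun R => ?_
    simp only [Function.comp, intervalIntegral, map_sub, integral_conj]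
  have hdc : Continuous fun x : ℝ => dslope F z x := by
    have h : ContinuousOn (dslope F z) {z | 0 ≤ z.im} := by
      rw [continuousOn_dslope hnhds']
      exact ⟨hFc, (hFd z hz).differentiableAt hnhds⟩
    exact h.comp_continuous continuous_ofReal fun x => by simp
  have hcc : Continuous fun x : ℝ => (starRingEnd ℂ) (m x / (x - zb)) :=
    continuous_conj.comp (hcx.div (by fun_prop) fun x => hne x (by simp))
  -- In the difference of the two integrands, m - m̄ leaves Im m and the correction leaves m(z)
  -- times a Poisson kernel, whose integral produces the factor π.
  set Ψ : ℝ → ℂ := fun x =>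
    ((m x).im : ℂ) * ((x : ℂ) - z)⁻¹ - m z * z.im * (((x - z.re) ^ 2 + z.im ^ 2)⁻¹ : ℝ) with hΨ
  have hpt : ∀ x : ℝ, dslope F z x - (starRingEnd ℂ) (m x / (x - zb)) = 2 * I * Ψ x := by
    intro x
    have h1 : (x : ℂ) ≠ z := fun h => hnex x (by rw [h, sub_self])
    have h2 := hnex x
    have h3 : (x : ℂ) - zb ≠ 0 := hne x (by simp)
    have h4 : (((x - z.re) ^ 2 + z.im ^ 2 : ℝ) : ℂ) = (x - zb) * (x - z) := by
      apply Complex.ext <;> simp [hzb, pow_two]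
      ring
    have h5 : z - zb = 2 * I * z.im := by
      apply Complex.ext <;> simp [hzb]
      ring
    have h6 : m x - (starRingEnd ℂ) (m x) = 2 * I * (m x).im := by
      apply Complex.ext <;> simp
      ring
    rw [dslope_of_ne _ h1, slope_def_field, hFz, sub_zero]
    simp only [hF, hΨ]
    rw [map_div₀, map_sub, conj_ofReal, hzb, conj_conj, ← hzb, ofReal_inv, h4, h5]
    field_simp
    linear_combination (x - zb) * h6
  have hPi : Integrable fun x : ℝ =>
      m z * z.im * ((((x - z.re) ^ 2 + z.im ^ 2)⁻¹ : ℝ) : ℂ) :=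
    (integral_inv_sq_add_sq hz z.re).1.ofReal.const_mul (m z * z.im)
  have hΨi : Integrable Ψ := hint.sub hPi
  have lim4 := intervalIntegral_tendsto_integral (hΨi.const_mul (2 * I)) tendsto_neg_atTop_atBot
    tendsto_id
  have lim5 : Tendsto (fun R : ℝ => ∫ x in (-R)..R, 2 * I * Ψ x) atTop (𝓝 0) := by
    have := lim1.sub lim3
    rw [sub_zero] at this
    refine this.congr fun R => ?_
    rw [← intervalIntegral.integral_sub (hdc.intervalIntegrable _ _) (hcc.intervalIntegrable _ _)]
    simp only [hpt]
  have h0 := tendsto_nhds_unique lim4 lim5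
  rw [integral_const_mul] at h0
  have h1 : ∫ x, Ψ x = 0 := by simpa using h0
  simp only [hΨ] at h1
  rw [integral_sub hint hPi, integral_const_mul, integral_complex_ofReal, (integral_inv_sq_add_sq hz z.re).2, sub_eq_zero] at h1
  rw [h1]
  have : (z.im : ℂ) ≠ 0 := ofReal_ne_zero.2 hz.ne'
  push_cast
  field_simp

open Topology Filter Complex in
/-- The total mass is read off from the Stieltjes transform along the imaginary axis. -/
lemma tendsto_stieltjes_mass {f : ℝ → ℝ} (hf : Integrable f) :
    Tendsto (fun y : ℝ => -(y * I) * ∫ x : ℝ, (f x : ℂ) * ((x : ℂ) - y * I)⁻¹) atTop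
      (𝓝 ((∫ x, f x : ℝ) : ℂ)) := by
  rw [← integral_complex_ofReal]
  simp_rw [← integral_const_mul]
  have hle : ∀ x y : ℝ, 0 < y → ‖-(y * I) * ((x : ℂ) - y * I)⁻¹‖ ≤ 1 := by
    intro x y hy
    have h := Complex.abs_im_le_norm ((x : ℂ) - y * I)
    simp at h
    have h0 : 0 < |y| := abs_pos.2 hy.ne'
    rw [norm_mul, norm_neg, norm_mul, norm_I, mul_one, norm_inv, norm_real, Real.norm_eq_abs,
      ← div_eq_mul_inv, div_le_one (h0.trans_le h)]
    exact h
  refine tendsto_integral_filter_of_dominated_convergence (fun x => ‖f x‖) ?_ ?_ hf.norm ?_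
  · refine Eventually.of_forall fun y => ?_
    have : Measurable fun x : ℝ => ((x : ℂ) - y * I)⁻¹ := by fun_prop
    exact (hf.ofReal.aestronglyMeasurable.mul this.aestronglyMeasurable).const_mul _
  · filter_upwards [eventually_gt_atTop 0] with y hy
    refine Eventually.of_forall fun x => ?_
    rw [mul_left_comm, norm_mul, norm_real]
    exact mul_le_of_le_one_right (norm_nonneg _) (hle x y hy)
  · refine Eventually.of_forall fun x => ?_
    have h1 : Tendsto (fun y : ℝ => (f x : ℂ) * (1 - x * ((x : ℂ) - y * I)⁻¹)) atTop
        (𝓝 ((f x : ℂ) * (1 - x * 0))) := by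
      refine tendsto_const_nhds.mul (tendsto_const_nhds.sub (tendsto_const_nhds.mul ?_))
      rw [tendsto_zero_iff_norm_tendsto_zero]
      refine squeeze_zero' (Eventually.of_forall fun _ => norm_nonneg _) ?_ tendsto_inv_atTop_zero
      filter_upwards [eventually_gt_atTop 0] with y hy
      rw [norm_inv]
      have h := Complex.abs_im_le_norm ((x : ℂ) - y * I)
      simp at h
      exact inv_anti₀ hy ((le_abs_self y).trans h)
    rw [mul_zero, sub_zero, mul_one] at h1
    refine h1.congr' ?_
    filter_upwards [eventually_gt_atTop 0] with y hy
    have hne : (x : ℂ) - y * I ≠ 0 := by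
      intro h0
      have := congrArg Complex.im h0
      simp at this
      exact hy.ne' this
    field_simp
    ring

/-! ### Size of the imaginary part inside and outside the support. -/

lemma Comparable.mono {K K' x y : ℝ} (h : Comparable K x y) (hK : 0 < K) (hKK : K ≤ K')
    (hy : 0 ≤ y) : Comparable K' x y := by
  refine ⟨le_trans ?_ h.1, h.2.trans ?_⟩ <;> gcongr

lemma comparable_of_inside {a : ℝ} (ha : |a| ≤ 1 / 10000) {z w : ℂ} (h : IsRoot a z w)
    (hE : |z.re| ≤ edge a) (h0 : 0 ≤ z.im) (h3 : z.im ≤ 3) :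
    Comparable 600 w.im (√(kappa (edge a) z.re + z.im)) := by
  have hE3 : |z.re| ≤ 3 := by linarith [(edge_bounds ha).2]
  obtain ⟨h1, h2⟩ := sqrt_kappa_bounds ha h hE3 h0 h3
  have hn := one_div_five_le_norm ha h hE3 h0 h3
  have hp : 1 / 25 ≤ w.re ^ 2 + w.im ^ 2 := by rw [← sq_norm_eq]; nlinarith
  have h4 := (inside_outside ha h hp).1 (sq_le_sq' (abs_le.1 hE).1 (abs_le.1 hE).2)
  have hD : 0 ≤ defect a w := h.2.2.2
  have hT := Real.sqrt_nonneg (kappa (edge a) z.re + z.im)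
  constructor <;> linarith

lemma sq_edge_le {a : ℝ} (ha : |a| ≤ 1 / 10000) {E : ℝ} (hE : E ∉ Set.Ioo (-edge a) (edge a)) :
    edge a ^ 2 ≤ E ^ 2 := by
  rw [← sq_abs E]
  have h0 : 0 ≤ edge a := by linarith [(edge_bounds ha).1]
  have : edge a ≤ |E| := by
    by_contra! hlt
    exact hE (abs_lt.1 hlt)
  gcongr

/-- Here D carries the size √(κ + η), and Im w = η|w|²/D with |w| bounded above and below. -/
lemma comparable_of_outside {a : ℝ} (ha : |a| ≤ 1 / 10000) {z w : ℂ} (h : IsRoot a z w)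
    (hE3 : |z.re| ≤ 3) (hE : z.re ∉ Set.Ioo (-edge a) (edge a)) (h0 : 0 < z.im) (h3 : z.im ≤ 3) :
    Comparable 1000 w.im (z.im / √(kappa (edge a) z.re + z.im)) := by
  obtain ⟨h1, h2⟩ := sqrt_kappa_bounds ha h hE3 h0.le h3
  have hn := one_div_five_le_norm ha h hE3 h0.le h3
  have hp : 1 / 25 ≤ w.re ^ 2 + w.im ^ 2 := by rw [← sq_norm_eq]; nlinarith
  have hp' := h.normSq_le ha
  have h4 := (inside_outside ha h hp).2 (sq_edge_le ha hE)
  have hv := h.im_pos h0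
  have hT : 0 < √(kappa (edge a) z.re + z.im) :=
    Real.sqrt_pos.2 (add_pos_of_nonneg_of_pos (kappa_nonneg _ _) h0)
  have he := (re_im_of_eq h.1).1
  constructor
  · rw [mul_div_assoc', div_le_iff₀ hT]
    nlinarith
  · rw [mul_div_assoc', le_div_iff₀ hT]
    nlinarith

/-- For real z the product Im w · D vanishes, so Im w > 0 would force D = 0, against Im w ≤ 2D. -/
lemma im_eq_zero_of_outside {a : ℝ} (ha : |a| ≤ 1 / 10000) {z w : ℂ} (h : IsRoot a z w)
    (hz : z.im = 0) (hE : z.re ∉ Set.Ioo (-edge a) (edge a)) : w.im = 0 := by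
  by_contra hne
  have hv : 0 < w.im := lt_of_le_of_ne h.2.1 (Ne.symm hne)
  have he := (re_im_of_eq h.1).1
  rw [hz, zero_mul] at he
  have hD : defect a w = 0 := by
    rcases mul_eq_zero.1 he.symm with h1 | h1
    · exact absurd h1 hne
    · exact h1
  -- E is arbitrary here, so the lower bound for bounded z is unavailable; D = 0 itself forces |w|
  -- to be near 1.
  have hp : 1 / 25 ≤ w.re ^ 2 + w.im ^ 2 := by
    have hp' := h.normSq_le ha
    have h1 : |3 * w.re ^ 2 - w.im ^ 2| ≤ 4 := by
      rw [abs_le]; constructor <;> nlinarith [sq_nonneg w.re, sq_nonneg w.im]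
    have h2 : |a * (3 * w.re ^ 2 - w.im ^ 2)| ≤ 1 / 10000 * 4 := by
      rw [abs_mul]; gcongr
    have h3 := abs_le.1 h2
    unfold defect at hD
    nlinarith [sq_nonneg w.re, sq_nonneg w.im]
  have := (inside_outside ha h hp).2 (sq_edge_le ha hE)
  linarith

/-! ### The density and the limiting law. -/

/-- The boundary density `Im w(E) / π`. -/
def density (a : ℝ) (E : ℝ) : ℝ := (branch a E).im / Real.pi

section density
variable {a : ℝ}

lemma isRoot_branch_ofReal (ha : |a| ≤ 1 / 10000) (E : ℝ) : IsRoot a E (branch a E) :=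
  isRoot_branch ha (by simp)

lemma density_nonneg (ha : |a| ≤ 1 / 10000) (E : ℝ) : 0 ≤ density a E :=
  div_nonneg (isRoot_branch_ofReal ha E).2.1 Real.pi_pos.le

lemma continuous_density (ha : |a| ≤ 1 / 10000) : Continuous (density a) := by
  have h : Continuous fun x : ℝ => branch a x :=
    (continuousOn_branch ha).comp_continuous Complex.continuous_ofReal fun x => by simp
  exact (Complex.continuous_im.comp h).div_const _

lemma density_eq_zero (ha : |a| ≤ 1 / 10000) {E : ℝ} (hE : E ∉ Set.Ioo (-edge a) (edge a)) :
    density a E = 0 := by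
  rw [density, im_eq_zero_of_outside ha (isRoot_branch_ofReal ha E) (by simp) (by simpa using hE),
    zero_div]

lemma hasCompactSupport_density (ha : |a| ≤ 1 / 10000) : HasCompactSupport (density a) :=
  HasCompactSupport.intro (isCompact_Icc (a := -edge a) (b := edge a)) fun _ hE =>
    density_eq_zero ha fun h => hE (Set.Ioo_subset_Icc_self h)

lemma integrable_density (ha : |a| ≤ 1 / 10000) : Integrable (density a) :=
  (continuous_density ha).integrable_of_hasCompactSupport (hasCompactSupport_density ha)

lemma comparable_density (ha : |a| ≤ 1 / 10000) {E : ℝ} (hE : E ∈ Set.Ioo (-edge a) (edge a)) :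
    Comparable 2400 (density a E) (√(kappa (edge a) E)) := by
  have h := comparable_of_inside ha (isRoot_branch_ofReal ha E)
    (by simpa using (abs_lt.2 hE).le) (by simp) (by simp)
  simp only [Complex.ofReal_re, Complex.ofReal_im, add_zero] at h
  obtain ⟨h1, h2⟩ := h
  have hT := Real.sqrt_nonneg (kappa (edge a) E)
  have p3 := Real.pi_gt_three
  have p4 := Real.pi_le_four
  unfold density
  constructor
  · rw [le_div_iff₀ Real.pi_pos]
    nlinarith
  · rw [div_le_iff₀ Real.pi_pos]
    nlinarith

lemma density_pos (ha : |a| ≤ 1 / 10000) {E : ℝ} (hE : E ∈ Set.Ioo (-edge a) (edge a)) :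
    0 < density a E := by
  refine lt_of_lt_of_le ?_ (comparable_density ha hE).1
  have : 0 < kappa (edge a) E := by
    refine lt_min (abs_pos.2 ?_) (abs_pos.2 ?_)
    · linarith [hE.1]
    · linarith [hE.2]
  have := Real.sqrt_pos.2 this
  positivity

lemma integral_density_mul_inv (ha : |a| ≤ 1 / 10000) {z : ℂ} (hz : 0 < z.im) :
    ∫ x : ℝ, (density a x : ℂ) * ((x : ℂ) - z)⁻¹ = branch a z := by
  have hpi : (Real.pi : ℂ) ≠ 0 := Complex.ofReal_ne_zero.2 Real.pi_pos.ne'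
  have he : ∀ x : ℝ, ((branch a x).im : ℂ) * ((x : ℂ) - z)⁻¹ =
      Real.pi * ((density a x : ℂ) * ((x : ℂ) - z)⁻¹) := by
    intro x
    rw [density]
    push_cast
    field_simp
  have hint : Integrable fun x : ℝ => ((branch a x).im : ℂ) * ((x : ℂ) - z)⁻¹ := by
    simp_rw [he]
    refine Integrable.const_mul ?_ _
    have hc : Continuous fun x : ℝ => (density a x : ℂ) * ((x : ℂ) - z)⁻¹ := by
      refine (Complex.continuous_ofReal.comp (continuous_density ha)).mul
        (Continuous.inv₀ (by fun_prop) fun x h0 => ?_)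
      have := congrArg Complex.im h0
      simp at this
      linarith
    refine hc.integrable_of_hasCompactSupport ?_
    exact HasCompactSupport.mul_right ((hasCompactSupport_density ha).comp_left Complex.ofReal_zero)
  have h := integral_im_mul_inv_eq (continuousOn_branch ha) (differentiableOn_branch ha)
    (R₀ := 10) (B := 5) (by norm_num) (fun z hz h => norm_branch_le ha hz h) hz hint
  simp_rw [he] at h
  rw [integral_const_mul] at h
  exact mul_left_cancel₀ hpi h

open Topology Filter Complex in
lemma integral_density (ha : |a| ≤ 1 / 10000) : ∫ x, density a x = 1 := by
  have h1 := tendsto_stieltjes_mass (integrable_density ha)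
  have h2 : Tendsto (fun y : ℝ => -(y * I) * ∫ x : ℝ, (density a x : ℂ) * ((x : ℂ) - y * I)⁻¹)
      atTop (𝓝 1) := by
    rw [tendsto_iff_norm_sub_tendsto_zero]
    have h3 : Tendsto (fun y : ℝ => 50 / y) atTop (𝓝 0) := tendsto_const_nhds.div_atTop tendsto_id
    refine squeeze_zero' (Eventually.of_forall fun _ => norm_nonneg _) ?_ h3
    filter_upwards [eventually_ge_atTop 10] with y hy
    have hyi : 0 < ((y : ℂ) * I).im := by simp; linarith
    have hyn : ‖(y : ℂ) * I‖ = y := by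
      rw [norm_mul, norm_I, mul_one, norm_real, Real.norm_eq_abs, abs_of_nonneg (by linarith)]
    rw [integral_density_mul_inv ha hyi]
    have h4 := norm_branch_mul_le ha hyi.le
    have h5 := norm_branch_le ha hyi.le (by rw [hyn]; exact hy)
    rw [hyn] at h5
    rw [show -(y * I) * branch a (y * I) - 1 = -(branch a (y * I) * (y * I) + 1) by ring, norm_neg]
    refine h4.trans ?_
    calc 2 * ‖branch a (y * I)‖ ^ 2 ≤ 2 * (5 / y) ^ 2 := by gcongr
      _ = 50 / y * (1 / y) := by ring
      _ ≤ 50 / y * 1 := by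
        gcongr
        rw [div_le_one (by linarith)]
        linarith
      _ = 50 / y := mul_one _
  exact_mod_cast tendsto_nhds_unique h1 h2

/-- The probability measure whose Stieltjes transform is `branch a`. -/
def limitLaw (a : ℝ) : Measure ℝ := volume.withDensity fun E => ENNReal.ofReal (density a E)

lemma measurable_ofReal_density (ha : |a| ≤ 1 / 10000) :
    Measurable fun E => ENNReal.ofReal (density a E) :=
  (continuous_density ha).measurable.ennreal_ofReal

lemma isProbabilityMeasure_limitLaw (ha : |a| ≤ 1 / 10000) :
    IsProbabilityMeasure (limitLaw a) := by
  constructor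
  rw [limitLaw, withDensity_apply _ MeasurableSet.univ, Measure.restrict_univ,
    ← ofReal_integral_eq_lintegral_ofReal (integrable_density ha)
      (Filter.Eventually.of_forall (density_nonneg ha)), integral_density ha, ENNReal.ofReal_one]

lemma stieltjes_limitLaw (ha : |a| ≤ 1 / 10000) {z : ℂ} (hz : 0 < z.im) :
    branch a z = stieltjes (limitLaw a) z := by
  rw [stieltjes, limitLaw, integral_withDensity_eq_integral_toReal_smul
    (measurable_ofReal_density ha) (Filter.Eventually.of_forall fun _ => ENNReal.ofReal_lt_top),
    ← integral_density_mul_inv ha hz]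
  refine integral_congr_ae (Filter.Eventually.of_forall fun x => ?_)
  simp only
  rw [ENNReal.toReal_ofReal (density_nonneg ha x), Complex.real_smul]

open Topology in
lemma support_limitLaw (ha : |a| ≤ 1 / 10000) :
    (limitLaw a).support = Set.Icc (-edge a) (edge a) := by
  have hL := (edge_bounds ha).1
  refine Set.Subset.antisymm ?_ ?_
  · refine Measure.support_subset_of_isClosed isClosed_Icc ?_
    rw [mem_ae_iff, limitLaw, withDensity_apply_eq_zero (measurable_ofReal_density ha)]
    convert measure_empty (μ := volume)
    rw [Set.eq_empty_iff_forall_notMem]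
    rintro E ⟨h1, h2⟩
    apply h1
    rw [density_eq_zero ha fun h => h2 (Set.Ioo_subset_Icc_self h), ENNReal.ofReal_zero]
  · rw [← closure_Ioo (by linarith)]
    refine closure_minimal ?_ Measure.isClosed_support
    intro E hE
    rw [Measure.mem_support_iff_forall]
    intro U hU
    rw [pos_iff_ne_zero, limitLaw, Ne, withDensity_apply_eq_zero (measurable_ofReal_density ha)]
    refine (Measure.measure_pos_of_mem_nhds volume (x := E) (Filter.inter_mem ?_ hU)).ne'
    filter_upwards [Ioo_mem_nhds hE.1 hE.2] with x hx
    simpa using density_pos ha hx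

end density

/-! ### Cumulant bound and smallness of the perturbation. -/

lemma isSolution_iff {q s t a : ℝ} (ha : |a| ≤ 1 / 10000)
    (hdef : a = Real.exp (-t) * (qt q t ^ 2)⁻¹ * s) {z w : ℂ} (hz : 0 < z.im) :
    IsSolution q s t z w ↔ w = branch a z := by
  have hb := isRoot_branch ha hz.le
  unfold IsSolution P
  rw [← hdef]
  constructor
  · rintro ⟨h1, h2, h3⟩
    exact (isRoot_of_im_pos h1 hz h2 h3).unique ha hb
  · rintro rfl
    exact ⟨hb.1, hb.im_pos hz, hb.2.2.1⟩

lemma cumulant_four {Ω : Type*} [MeasurableSpace Ω] (μ : Measure Ω) (X : Ω → ℝ)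
    (h : moment X 1 μ = 0) : cumulant μ X 4 = moment X 4 μ - 3 * moment X 2 μ ^ 2 := by
  have h1 : cumulant μ X 1 = 0 := by
    rw [cumulant]
    simp [h]
  have h2 : cumulant μ X 2 = moment X 2 μ := by
    rw [cumulant]
    simp [h1]
  rw [cumulant]
  simp [Fin.sum_univ_succ, h1, h2, h]
  ring

/-- The first summand bounds N q² times the fourth moment; the 3 comes from 3 N q² (1/N)² = 3q²/N
and q ≤ √N. -/
lemma abs_normalizedCumulant_le {φ C c : ℝ} {N : ℕ} {q : ℝ} {Ω : Type*} [MeasurableSpace Ω]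
    {μ : Measure Ω} {H : Ω → Matrix (Fin N) (Fin N) ℝ} (hH : IsSparseMatrix φ C c q μ H)
    {i j : Fin N} (hij : i ≠ j) :
    |normalizedCumulant μ N q (fun ω => H ω i j) 4| ≤ (C * 4) ^ (c * 4) + 3 := by
  have hN : 0 < (N : ℝ) := by
    have := i.pos
    exact_mod_cast this
  have hq : 0 < q := lt_of_lt_of_le (Real.rpow_pos_of_pos hN φ) hH.le_q
  have m1 : moment (fun ω => H ω i j) 1 μ = 0 := by
    simpa [moment] using hH.mean i j
  have m2 : moment (fun ω => H ω i j) 2 μ = 1 / N := by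
    simpa [moment, hij] using hH.variance i j
  have m4 : moment (fun ω => H ω i j) 4 μ ≤ (C * 4) ^ (c * 4) / (N * q ^ 2) := by
    have h := hH.moment_le i j 4 (by norm_num)
    simpa [moment, Even.pow_abs (show Even 4 by decide)] using h
  have m40 : 0 ≤ moment (fun ω => H ω i j) 4 μ := by
    simp only [moment, Pi.pow_apply]
    exact integral_nonneg fun ω => Even.pow_nonneg (by decide) _
  have hs : normalizedCumulant μ N q (fun ω => H ω i j) 4 =
      N * q ^ 2 * moment (fun ω => H ω i j) 4 μ - 3 * (q ^ 2 / N) := by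
    rw [normalizedCumulant, cumulant_four μ _ m1, m2]
    field_simp
    ring
  have hq2 : q ^ 2 / N ≤ 1 := by
    rw [div_le_one hN]
    calc q ^ 2 ≤ ((N : ℝ) ^ (1 / 2 : ℝ)) ^ 2 := by
          have := hH.q_le
          gcongr
      _ = (N : ℝ) := by rw [← Real.sqrt_eq_rpow, Real.sq_sqrt hN.le]
  have hq20 : 0 ≤ q ^ 2 / N := by positivity
  have hm : N * q ^ 2 * moment (fun ω => H ω i j) 4 μ ≤ (C * 4) ^ (c * 4) := by
    rw [le_div_iff₀ (by positivity)] at m4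
    linarith
  have hm0 : 0 ≤ N * q ^ 2 * moment (fun ω => H ω i j) 4 μ := by positivity
  rw [hs, abs_le]
  constructor <;> linarith

lemma exists_nat_div_rpow_le {φ : ℝ} (hφ : 0 < φ) (S : ℝ) :
    ∃ N₀ : ℕ, 1 ≤ N₀ ∧ ∀ N : ℕ, N₀ ≤ N → S / ((N : ℝ) ^ φ) ^ 2 ≤ 1 / 10000 := by
  have h1 : Filter.Tendsto (fun N : ℕ => S / ((N : ℝ) ^ φ) ^ 2) Filter.atTop (nhds 0) := by
    refine tendsto_const_nhds.div_atTop ?_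
    exact (Filter.tendsto_pow_atTop two_ne_zero).comp
      ((tendsto_rpow_atTop hφ).comp tendsto_natCast_atTop_atTop)
  have h2 := h1.eventually_le_const (show (0 : ℝ) < 1 / 10000 by norm_num)
  obtain ⟨N₀, h⟩ := Filter.eventually_atTop.1 h2
  exact ⟨max N₀ 1, le_max_right _ _, fun N hN => h N ((le_max_left _ _).trans hN)⟩

end SparseRM

end

theorem lemma3p1 (φ C c : ℝ) (hφ : 0 < φ) (hC : 0 < C) (hc : 0 < c) :
    -- the threshold `N₀` and the constant `K` depend only on `φ`, `C`, `c`
    ∃ N₀ : ℕ, ∃ K : ℝ, 1 ≤ K ∧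
      ∀ N : ℕ, N₀ ≤ N → ∀ (q : ℝ) (Ω : Type*) [MeasurableSpace Ω] (μ : Measure Ω)
        [IsProbabilityMeasure μ] (H : Ω → Matrix (Fin N) (Fin N) ℝ),
        SparseRM.IsSparseMatrix φ C c q μ H →
        ∀ i j : Fin N, i ≠ j → ∀ s : ℝ,
          s = SparseRM.normalizedCumulant μ N q (fun ω => H ω i j) 4 →
        ∀ t : ℝ, 0 ≤ t →
          -- existence and uniqueness of the root
          (∀ z ∈ SparseRM.domainE, ∃! w : ℂ, SparseRM.IsSolution q s t z w) ∧
          ∃ (m : ℂ → ℂ) (ρ : Measure ℝ) (f : ℝ → ℝ) (L : ℝ),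
            -- (i) the root continues analytically to a Stieltjes transform
            IsProbabilityMeasure ρ ∧
            AnalyticOnNhd ℂ m {z : ℂ | 0 < z.im} ∧
            (∀ z ∈ SparseRM.domainE, SparseRM.IsSolution q s t z (m z)) ∧
            (∀ z : ℂ, 0 < z.im → m z = SparseRM.stieltjes ρ z) ∧
            -- (ii) support, density and edges
            0 < L ∧ (0 ≤ s → 2 ≤ L) ∧
            ρ.support = Set.Icc (-L) L ∧
            Measurable f ∧ (∀ E, 0 ≤ f E) ∧
            ρ = volume.withDensity (fun E => ENNReal.ofReal (f E)) ∧
            (∀ E ∈ Set.Ioo (-L) L, 0 < f E) ∧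
            (∀ E ∈ Set.Ioo (-L) L,
              SparseRM.Comparable K (f E) (√(SparseRM.kappa L E))) ∧
            |L - (2 + Real.exp (-t) * (SparseRM.qt q t ^ 2)⁻¹ * s)| ≤
              K * (Real.exp (-2 * t) * (SparseRM.qt q t ^ 4)⁻¹) ∧
            -- (iii) behaviour of the imaginary part of the root
            (∀ z ∈ SparseRM.domainE, z.re ∈ Set.Icc (-L) L →
              SparseRM.Comparable K (m z).im (√(SparseRM.kappa L z.re + z.im))) ∧
            (∀ z ∈ SparseRM.domainE, z.re ∉ Set.Icc (-L) L →
              SparseRM.Comparable K (m z).im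
                (z.im / √(SparseRM.kappa L z.re + z.im))) := by
  set S : ℝ := (C * 4) ^ (c * 4) + 3 with hS
  have hS0 : 0 ≤ S := by positivity
  obtain ⟨N₀, hN₀, hsmall⟩ := SparseRM.exists_nat_div_rpow_le hφ S
  -- 2400 covers all three comparison constants, the largest being the density's 4 · 600 from π ≤ 4;
  -- 11 S² covers the edge error 11 a².
  refine ⟨N₀, 2400 + 11 * S ^ 2, by nlinarith [sq_nonneg S], ?_⟩
  intro N hN q Ω _ μ _ H hH i j hij s hs t ht
  have hNpos : 0 < (N : ℝ) := by exact_mod_cast hN₀.trans hN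
  have hNφ : 0 < (N : ℝ) ^ φ := Real.rpow_pos_of_pos hNpos φ
  have hq : 0 < q := hNφ.trans_le hH.le_q
  have hsS : |s| ≤ S := hs ▸ SparseRM.abs_normalizedCumulant_le hH hij
  have hqt : 0 < SparseRM.qt q t := mul_pos hq (Real.exp_pos _)
  have hqle : q ≤ SparseRM.qt q t := le_mul_of_one_le_right hq.le (Real.one_le_exp (by linarith))
  set a : ℝ := Real.exp (-t) * (SparseRM.qt q t ^ 2)⁻¹ * s with hadef
  have ha : |a| ≤ 1 / 10000 := by
    refine le_trans ?_ (hsmall N hN)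
    have h1 : Real.exp (-t) ≤ 1 := Real.exp_le_one_iff.2 (by linarith)
    have h2 : (SparseRM.qt q t ^ 2)⁻¹ ≤ (((N : ℝ) ^ φ) ^ 2)⁻¹ := by
      have := hH.le_q.trans hqle
      gcongr
    rw [hadef, abs_mul, abs_of_nonneg (by positivity)]
    calc Real.exp (-t) * (SparseRM.qt q t ^ 2)⁻¹ * |s| ≤ 1 * (((N : ℝ) ^ φ) ^ 2)⁻¹ * S := by gcongr
      _ = _ := by rw [one_mul, mul_comm, div_eq_mul_inv]
  have hK : (2400 : ℝ) ≤ 2400 + 11 * S ^ 2 := by nlinarith [sq_nonneg S]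
  have hopenH : IsOpen {z : ℂ | 0 < z.im} := isOpen_lt continuous_const Complex.continuous_im
  refine ⟨fun z hz => ⟨SparseRM.branch a z, (SparseRM.isSolution_iff ha hadef hz.2.1).2 rfl,
    fun w hw => (SparseRM.isSolution_iff ha hadef hz.2.1).1 hw⟩, SparseRM.branch a, SparseRM.limitLaw a, SparseRM.density a, SparseRM.edge a,
    SparseRM.isProbabilityMeasure_limitLaw ha, (SparseRM.differentiableOn_branch ha).analyticOnNhd hopenH,
    fun z hz => (SparseRM.isSolution_iff ha hadef hz.2.1).2 rfl, fun z hz => SparseRM.stieltjes_limitLaw ha hz,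
    by linarith [(SparseRM.edge_bounds ha).1], fun h => SparseRM.two_le_edge ha (by positivity), SparseRM.support_limitLaw ha,
    (SparseRM.continuous_density ha).measurable, SparseRM.density_nonneg ha, rfl, fun E hE => SparseRM.density_pos ha hE,
    fun E hE => (SparseRM.comparable_density ha hE).mono (by norm_num) hK (Real.sqrt_nonneg _), ?_, ?_, ?_⟩
  · refine (SparseRM.abs_edge_sub_le ha).trans ?_
    have h1 : a ^ 2 = s ^ 2 * (Real.exp (-2 * t) * (SparseRM.qt q t ^ 4)⁻¹) := by
      rw [hadef, show -2 * t = -t + -t by ring, Real.exp_add]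
      field_simp
    have h2 : s ^ 2 ≤ S ^ 2 := by
      rw [← sq_abs]
      gcongr
    rw [h1, ← mul_assoc]
    gcongr
    linarith
  · intro z hz hE
    exact (SparseRM.comparable_of_inside ha (SparseRM.isRoot_branch ha hz.2.1.le) (abs_le.2 hE) hz.2.1.le
      hz.2.2).mono (by norm_num) (by linarith) (Real.sqrt_nonneg _)
  · intro z hz hE
    exact (SparseRM.comparable_of_outside ha (SparseRM.isRoot_branch ha hz.2.1.le) hz.1.le
      (fun h => hE (Set.Ioo_subset_Icc_self h)) hz.2.1 hz.2.2).mono (by norm_num) (by linarith)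
      (div_nonneg hz.2.1.le (Real.sqrt_nonneg _))
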